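/- **Lemma (equivalence of matrix sparsification and sparse null space).** All matrices are over $\mathbb{Q}$, of arbitrary finite size (empty matrices allowed), and $\mathrm{nnz}(N)$ is the number of nonzero entries of $N$. An $m\times n$ matrix is *full rank* if its columns are linearly independent. An $n\times k$ matrix $N$ is a *full null matrix* for an $m\times n$ matrix $A$ if $N$ is full rank and its columns span the null space $\{b\in\mathbb{Q}^n : Ab=0\}$. A minimization problem $F$ consists of a set $\mathcal{I}_F$ of instances, a solution space $S_F(x)$ for each $x\in\mathcal{I}_F$, and an objective $M_F(x,y)$ for $y\in S_F(x)$, to be minimized over $y$; write $\|F(x)\| = \min_{y\in S_F(x)} M_F(x,y)$. * Sparse null space (SNS): the instances are all matrices $A$; $S_{\mathsf{SNS}}(A)$ is the set of full null matrices for $A$; $M_{\mathsf{SNS}}(A,N)=\mathrm{nnz}(N)$. * Matrix sparsification (MS): the instances are all full rank matrices $B$; $S_{\mathsf{MS}}(B)=\{BX : X \text{ an invertible matrix}\}$; $M_{\mathsf{MS}}(B,N)=\mathrm{nnz}(N)$. An *exact reduction* from $F$ to $G$ is a pair $\langle t_1,t_2\rangle$ of functions such that 1. $t_1$ and $t_2$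 are computable in polynomial time, measured in bit operations in the bit length of the input (a rational entry is given by its reduced numerator and denominator in binary, the two dimensions of a matrix in unary); 2. $t_1$ maps $\mathcal{I}_F$ to $\mathcal{I}_G$, and $t_2(x,y)\in S_F(x)$ for all $x\in\mathcal{I}_F$ and $y\in S_G(t_1(x))$; 3. $M_F(x,t_2(x,y)) = M_G(t_1(x),y)$ for all $x\in\mathcal{I}_F$ and $y\in S_G(t_1(x))$; 4. $\|F(x)\|\ge \|G(t_1(x))\|$ for all $x\in\mathcal{I}_F$. Two problems $F$ and $G$ are *equivalent* if there are an exact reduction from $F$ to $G$ and an exact reduction from $G$ to $F$. Then matrix sparsification and sparse null space are equivalent. -/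

import Mathlib

namespace SparseMat

/-! ### A random access machine with logarithmic cost

Programs act on integer variables and on integer arrays (random access memory with indirect
addressing). Every value that is read, written or computed, addresses included, is charged its bit
length, so cost is measured in bits and not in arithmetic operations. -/

/-- Length of the binary notation of an integer, with one extra bit for the sign. -/
def bitLen (z : ℤ) : ℕ := z.natAbs.size + 1

/-- The memory: variables and arrays, each family indexed by `ℕ`; array cells have integer
addresses. A program mentions only finitely many of the variables and arrays. -/
@[ext] structure Store where
  var : ℕ → ℤ
  arr : ℕ → ℤ → ℤ

/-- Arithmetic expressions; `div` is the integer quotient. -/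
inductive Exp where
  | const (z : ℤ)
  | var (x : ℕ)
  | read (a : ℕ) (i : Exp)
  | add (e₁ e₂ : Exp)
  | sub (e₁ e₂ : Exp)
  | mul (e₁ e₂ : Exp)
  | div (e₁ e₂ : Exp)

/-- Value of an expression. -/
def Exp.eval (s : Store) : Exp → ℤ
  | const z => z
  | var x => s.var x
  | read a i => s.arr a (i.eval s)
  | add e₁ e₂ => e₁.eval s + e₂.eval s
  | sub e₁ e₂ => e₁.eval s - e₂.eval s
  | mul e₁ e₂ => e₁.eval s * e₂.eval s
  | div e₁ e₂ => e₁.eval s / e₂.eval s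

/-- Cost of evaluating an expression: the bit lengths of all values that occur on the way. -/
def Exp.cost (s : Store) : Exp → ℕ
  | const z => bitLen z
  | var x => bitLen (s.var x)
  | read a i => i.cost s + bitLen (s.arr a (i.eval s))
  | add e₁ e₂ => e₁.cost s + e₂.cost s + bitLen (e₁.eval s + e₂.eval s)
  | sub e₁ e₂ => e₁.cost s + e₂.cost s + bitLen (e₁.eval s - e₂.eval s)
  | mul e₁ e₂ => e₁.cost s + e₂.cost s + bitLen (e₁.eval s * e₂.eval s)
  | div e₁ e₂ => e₁.cost s + e₂.cost s + bitLen (e₁.eval s / e₂.eval s)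

/-- Programs. `ite e c₁ c₂` runs `c₁` if `e` is positive and `c₂` otherwise; `loop e c` runs `c`
as long as `e` is positive. -/
inductive Prog where
  | skip
  | assign (x : ℕ) (e : Exp)
  | write (a : ℕ) (i e : Exp)
  | seq (c₁ c₂ : Prog)
  | ite (e : Exp) (c₁ c₂ : Prog)
  | loop (e : Exp) (c : Prog)

/-- `Exec c s s' t`: started in the store `s`, the program `c` halts in the store `s'`, at total
cost `t`. -/
inductive Exec : Prog → Store → Store → ℕ → Prop where
  | skip (s : Store) : Exec .skip s s 1
  | assign (x : ℕ) (e : Exp) (s : Store) :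
      Exec (.assign x e) s { s with var := Function.update s.var x (e.eval s) } (e.cost s + 1)
  | write (a : ℕ) (i e : Exp) (s : Store) :
      Exec (.write a i e) s
        { s with arr := Function.update s.arr a
                          (Function.update (s.arr a) (i.eval s) (e.eval s)) }
        (i.cost s + e.cost s + 1)
  | seq {c₁ c₂ : Prog} {s s' s'' : Store} {t₁ t₂ : ℕ}
      (h₁ : Exec c₁ s s' t₁) (h₂ : Exec c₂ s' s'' t₂) : Exec (.seq c₁ c₂) s s'' (t₁ + t₂)
  | ite_pos {e : Exp} {c₁ c₂ : Prog} {s s' : Store} {t : ℕ}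
      (he : 0 < e.eval s) (h : Exec c₁ s s' t) : Exec (.ite e c₁ c₂) s s' (e.cost s + 1 + t)
  | ite_neg {e : Exp} {c₁ c₂ : Prog} {s s' : Store} {t : ℕ}
      (he : ¬ 0 < e.eval s) (h : Exec c₂ s s' t) : Exec (.ite e c₁ c₂) s s' (e.cost s + 1 + t)
  | loop_pos {e : Exp} {c : Prog} {s s' s'' : Store} {t₁ t₂ : ℕ}
      (he : 0 < e.eval s) (h₁ : Exec c s s' t₁) (h₂ : Exec (.loop e c) s' s'' t₂) :
      Exec (.loop e c) s s'' (e.cost s + 1 + t₁ + t₂)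
  | loop_neg {e : Exp} {c : Prog} {s : Store}
      (he : ¬ 0 < e.eval s) : Exec (.loop e c) s s (e.cost s + 1)

/-- The initial store on the input words `ws`: the `i`-th word stands in array `i` at the addresses
`0, 1, …`, its length in variable `i`; everything else is `0`. -/
def Store.init (ws : List (List ℤ)) : Store where
  var i := ((ws.getD i []).length : ℤ)
  arr i j := if 0 ≤ j then (ws.getD i []).getD j.toNat 0 else 0

/-- The output word of a final store is `w`: its length stands in variable `0` and its letters in
array `0` at the addresses `0, 1, …`. -/
def Store.Outputs (s : Store) (w : List ℤ) : Prop :=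
  s.var 0 = (w.length : ℤ) ∧ ∀ j : ℕ, j < w.length → s.arr 0 (j : ℤ) = w.getD j 0

/-- Bit size of a word of integers. -/
def wordSize (w : List ℤ) : ℕ := (w.map bitLen).sum

/-- A function, given on encodings of inputs (each a list of words) and outputs, is computable in
polynomial time: one program computes it on all inputs, at a cost polynomial in the bit size of the
input. -/
def PolyTime {α β : Type} (encIn : α → List (List ℤ)) (encOut : β → List ℤ) (f : α → β) : Prop :=
  ∃ (c : Prog) (p : Polynomial ℕ), ∀ a : α, ∃ (s : Store) (t : ℕ),
    Exec c (Store.init (encIn a)) s t ∧ t ≤ p.eval ((encIn a).map wordSize).sum ∧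
      s.Outputs (encOut (f a))

/-! ### Optimization problems and exact reductions -/

/-- A minimization problem: instances and solution candidates with their encodings as words, the
solution space of each instance, and the objective. -/
structure MinProblem where
  Inst : Type
  Sol : Type
  encInst : Inst → List ℤ
  encSol : Sol → List ℤ
  encInst_injective : Function.Injective encInst
  encSol_injective : Function.Injective encSol
  S : Inst → Set Sol
  M : Inst → Sol → ℕ

/-- The optimal value of an instance (`⊤` if there is no solution). -/
noncomputable def MinProblem.opt (F : MinProblem) (x : F.Inst) : ℕ∞ :=
  ⨅ y ∈ F.S x, (F.M x y : ℕ∞)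

/-- The pair `(t₁, t₂)` is an exact reduction from `F` to `G`. -/
structure IsExactReduction (F G : MinProblem) (t₁ : F.Inst → G.Inst)
    (t₂ : F.Inst × G.Sol → F.Sol) : Prop where
  polyTime_fst : PolyTime (fun x => [F.encInst x]) G.encInst t₁
  polyTime_snd : PolyTime (fun p => [F.encInst p.1, G.encSol p.2]) F.encSol t₂
  mapsTo : ∀ x, ∀ y ∈ G.S (t₁ x), t₂ (x, y) ∈ F.S x
  objective_eq : ∀ x, ∀ y ∈ G.S (t₁ x), F.M x (t₂ (x, y)) = G.M (t₁ x) y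
  opt_le : ∀ x, G.opt (t₁ x) ≤ F.opt x

/-- `F` reduces exactly to `G`. -/
def ExactlyReducible (F G : MinProblem) : Prop :=
  ∃ t₁ t₂, IsExactReduction F G t₁ t₂

/-- Equivalence of minimization problems. -/
def Equivalent (F G : MinProblem) : Prop :=
  ExactlyReducible F G ∧ ExactlyReducible G F

/-! ### Rational matrices and the two problems -/

/-- A rational matrix of arbitrary size; empty matrices are allowed. -/
structure RatMatrix where
  rows : ℕ
  cols : ℕ
  entries : Matrix (Fin rows) (Fin cols) ℚ

/-- Encoding of a matrix: the two dimensions in unary, each closed by a `0`, and then the entries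
row by row, each as its numerator and its denominator. -/
def RatMatrix.code (A : RatMatrix) : List ℤ :=
  List.replicate A.rows 1 ++ 0 :: (List.replicate A.cols 1 ++ 0 ::
    (List.finRange A.rows).flatMap fun i => (List.finRange A.cols).flatMap fun j =>
      [(A.entries i j).num, ((A.entries i j).den : ℤ)])

theorem replicate_append_zero_inj {m n : ℕ} {u v : List ℤ}
    (h : List.replicate m 1 ++ 0 :: u = List.replicate n 1 ++ 0 :: v) : m = n ∧ u = v := by
  induction m generalizing n with
  | zero => cases n <;> simp_all [List.replicate_succ]
  | succ m ih =>
    cases n with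
    | zero => simp [List.replicate_succ] at h
    | succ n =>
      simp only [List.replicate_succ, List.cons_append, List.cons.injEq, true_and] at h
      obtain ⟨h₁, h₂⟩ := ih h
      exact ⟨by rw [h₁], h₂⟩

theorem flatMap_inj_of_length {ι : Type} {k : ℕ} (l : List ι) (f g : ι → List ℤ)
    (hf : ∀ i, (f i).length = k) (hg : ∀ i, (g i).length = k)
    (h : l.flatMap f = l.flatMap g) : ∀ i ∈ l, f i = g i := by
  induction l with
  | nil => simp
  | cons a l ih =>
    simp only [List.flatMap_cons] at h
    obtain ⟨h₁, h₂⟩ := List.append_inj h (by rw [hf, hg])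
    intro i hi
    rcases List.mem_cons.1 hi with rfl | hi
    · exact h₁
    · exact ih h₂ i hi

theorem RatMatrix.code_injective : Function.Injective RatMatrix.code := by
  rintro ⟨m, n, A⟩ ⟨m', n', B⟩ h
  simp only [RatMatrix.code] at h
  obtain ⟨rfl, h⟩ := replicate_append_zero_inj h
  obtain ⟨rfl, h⟩ := replicate_append_zero_inj h
  congr 1
  ext i j
  have h₁ := flatMap_inj_of_length (k := n * 2) _ _ _ (by simp [List.length_flatMap])
    (by simp [List.length_flatMap]) h i (List.mem_finRange i)
  have h₂ := flatMap_inj_of_length (k := 2) _ _ _ (by simp) (by simp) h₁ j (List.mem_finRange j)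
  simp only [List.cons.injEq, and_true] at h₂
  exact Rat.ext h₂.1 (by exact_mod_cast h₂.2)

/-- Number of nonzero entries. -/
def RatMatrix.nnz (A : RatMatrix) : ℕ :=
  (Finset.univ.filter fun ij : Fin A.rows × Fin A.cols => A.entries ij.1 ij.2 ≠ 0).card

/-- `A` is full rank: its columns are linearly independent. -/
def RatMatrix.FullRank (A : RatMatrix) : Prop :=
  LinearIndependent ℚ A.entries.col

/-- `N` is a full null matrix for `A`: it is full rank and its columns span the null space of
`A`. -/
def IsFullNullMatrix {m n k : ℕ} (A : Matrix (Fin m) (Fin n) ℚ) (N : Matrix (Fin n) (Fin k) ℚ) :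
    Prop :=
  LinearIndependent ℚ N.col ∧
    Submodule.span ℚ (Set.range N.col) = LinearMap.ker A.mulVecLin

/-- Sparse null space: given any matrix `A`, find a full null matrix for `A` with as few nonzero
entries as possible. -/
def sparseNullSpace : MinProblem where
  Inst := RatMatrix
  Sol := RatMatrix
  encInst := RatMatrix.code
  encSol := RatMatrix.code
  encInst_injective := RatMatrix.code_injective
  encSol_injective := RatMatrix.code_injective
  S A := {N | ∃ (k : ℕ) (N₀ : Matrix (Fin A.cols) (Fin k) ℚ),
    N = ⟨A.cols, k, N₀⟩ ∧ IsFullNullMatrix A.entries N₀}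
  M _ N := N.nnz

/-- Matrix sparsification: given a full rank matrix `B`, find a matrix of the form `B X`, with `X`
invertible, with as few nonzero entries as possible. -/
def matrixSparsification : MinProblem where
  Inst := {B : RatMatrix // B.FullRank}
  Sol := RatMatrix
  encInst B := B.1.code
  encSol := RatMatrix.code
  encInst_injective := RatMatrix.code_injective.comp Subtype.val_injective
  encSol_injective := RatMatrix.code_injective
  S B := {N | ∃ X : Matrix (Fin B.1.cols) (Fin B.1.cols) ℚ,
    IsUnit X ∧ N = ⟨B.1.rows, B.1.cols, B.1.entries * X⟩}
  M _ N := N.nnz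

end SparseMat

/-!
Both problems ask for the sparsest matrix with a given column space: the full null matrices of `A`
are exactly the products `N X`, where `N` is one full null matrix of `A` and `X` is invertible. So
if `N` is a full null matrix of `A`, then `A` and `N` have the same solutions with the same
objective, the reductions are `A ↦ N` and `N ↦ A`, and each second component is the projection
`(x, y) ↦ y`. To get from a full rank matrix `B` to a matrix with full null matrix `B`, transpose
a full null matrix of `Bᵀ`.

It remains to find a full null matrix in polynomial bit time. Clear denominators and maintain an
integer matrix `M`, initially `1`, with its determinant and adjugate. An equation `r ⬝ᵥ b = 0` that
fails on one of the columns of the adjugate that are still free, say column `p`, replaces the row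
`p` of `M`. The columns still free at the end span the null space. Cramer's rule gives
`det M * adj M' = (r adj M)_p * adj M - …` for the new matrix `M'`, so the update costs one exact
division, and since every stored number is a minor of a matrix with bounded entries, all bit
lengths stay polynomial.
-/

namespace SparseMat

open scoped Matrix

/-! ### Fraction-free elimination -/

section Adjugate

variable {R n : Type*} [CommRing R] [Fintype n] [DecidableEq n]

theorem det_updateRow_eq_vecMul_adjugate (M : Matrix n n R) (p : n) (r : n → R) :
    (M.updateRow p r).det = (r ᵥ* M.adjugate) p := by
  rw [← Matrix.cramer_transpose_apply, Matrix.cramer_eq_adjugate_mulVec,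
    ← Matrix.adjugate_transpose, Matrix.mulVec_transpose]

theorem adjugate_updateRow_apply_self (M : Matrix n n R) (p : n) (r : n → R) (x : n) :
    (M.updateRow p r).adjugate x p = M.adjugate x p := by
  simp only [Matrix.adjugate_apply, Matrix.updateRow_idem]

theorem det_updateRow_single_updateRow_row (M : Matrix n n R) {p k : n} (hk : k ≠ p) (x : n) :
    ((M.updateRow k (Pi.single x 1)).updateRow p (M k)).det = -M.adjugate x p := by
  set N := (M.updateRow k (Pi.single x 1)).updateRow p (M k) with hN
  have swap_rows : N.submatrix (Equiv.swap p k) id = M.updateRow p (Pi.single x 1) := by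
    ext j y
    obtain rfl | hjp := eq_or_ne j p
    · simp [hN, hk]
    obtain rfl | hjk := eq_or_ne j k
    · simp [hN, hjp]
    · simp [hN, Equiv.swap_apply_of_ne_of_ne hjp hjk, hjp, hjk]
  have det_swap := Matrix.det_permute (Equiv.swap p k) N
  rw [swap_rows, Equiv.Perm.sign_swap hk.symm, ← Matrix.adjugate_apply] at det_swap
  simp [det_swap]

theorem det_mul_adjugate_updateRow_apply (M : Matrix n n R) {p k : n} (hk : k ≠ p) (r : n → R)
    (x : n) : M.det * (M.updateRow p r).adjugate x k =
      (r ᵥ* M.adjugate) p * M.adjugate x k - (r ᵥ* M.adjugate) k * M.adjugate x p := by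
  set N := M.updateRow k (Pi.single x 1) with hN
  let f : (n → R) →ₗ[R] R := Matrix.detRowAlternating.toMultilinearMap.toLinearMap N p
  have f_apply (y : n → R) : f y = (N.updateRow p y).det := rfl
  have f_self : f (M p) = M.adjugate x k := by
    rw [f_apply, hN, Matrix.updateRow_comm _ hk, Matrix.updateRow_eq_self, Matrix.adjugate_apply]
  have f_swap : f (M k) = -M.adjugate x p := by
    rw [f_apply, det_updateRow_single_updateRow_row M hk]
  have f_other (j : n) (hjp : j ≠ p) (hjk : j ≠ k) : f (M j) = 0 := by
    rw [f_apply]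
    refine Matrix.det_zero_of_row_eq hjp ?_
    rw [Matrix.updateRow_self, Matrix.updateRow_ne hjp, hN, Matrix.updateRow_ne hjk]
  have expand : M.det • r = ∑ j, (r ᵥ* M.adjugate) j • M j := by
    rw [← Matrix.vecMul_eq_sum, Matrix.vecMul_vecMul, Matrix.adjugate_mul, Matrix.vecMul_smul,
      Matrix.vecMul_one]
  calc M.det * (M.updateRow p r).adjugate x k
    _ = f (M.det • r) := by
      rw [map_smul, f_apply, Matrix.adjugate_apply, hN, Matrix.updateRow_comm _ hk, smul_eq_mul]
    _ = ∑ j, (r ᵥ* M.adjugate) j * f (M j) := by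
      simp only [expand, map_sum, map_smul, smul_eq_mul]
    _ = (r ᵥ* M.adjugate) p * f (M p) + (r ᵥ* M.adjugate) k * f (M k) :=
      Fintype.sum_eq_add p k hk.symm fun j hj => by rw [f_other j hj.1 hj.2, mul_zero]
    _ = _ := by rw [f_self, f_swap]; ring

theorem abs_adjugate_le {R : Type*} [CommRing R] [LinearOrder R] [IsStrictOrderedRing R]
    {M : Matrix n n R} {B : R} (hB : 1 ≤ B) (hM : ∀ i j, |M i j| ≤ B) (x k : n) :
    |M.adjugate x k| ≤ (Fintype.card n).factorial * B ^ Fintype.card n := by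
  have entry_le (i j : n) : AbsoluteValue.abs (M.updateRow k (Pi.single x 1) i j) ≤ B := by
    change |_| ≤ B
    rw [Matrix.updateRow_apply]
    split_ifs
    · rw [Pi.single_apply]
      split_ifs
      · rwa [abs_one]
      · rw [abs_zero]; linarith
    · exact hM i j
  rw [Matrix.adjugate_apply, ← nsmul_eq_mul]
  exact Matrix.det_le entry_le

end Adjugate

section Pivoted

variable {R n : Type*} [CommRing R] [Fintype n] [DecidableEq n]

/-- The state of fraction-free (Bareiss) elimination after the equations `r ⬝ᵥ b = 0`, `r ∈ E`:
the rows of the invertible matrix `M` outside `F` are pivot equations, and the columns of its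
adjugate in `F` solve all equations. -/
structure IsPivoted (E : Set (n → R)) (M : Matrix n n R) (F : Finset n) : Prop where
  det_ne_zero : M.det ≠ 0
  row_mem : ∀ k ∉ F, M k ∈ E
  dotProduct_eq_zero : ∀ k ∈ F, ∀ r ∈ E, (r ᵥ* M.adjugate) k = 0

theorem isPivoted_one [Nontrivial R] : IsPivoted ∅ (1 : Matrix n n R) Finset.univ where
  det_ne_zero := by simp
  row_mem k hk := absurd (Finset.mem_univ k) hk
  dotProduct_eq_zero _ _ _ hr := hr.elim

variable {E : Set (n → R)} {M : Matrix n n R} {F : Finset n}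

theorem IsPivoted.insert_of_dotProduct_eq_zero (h : IsPivoted E M F) {r : n → R}
    (hr : ∀ k ∈ F, (r ᵥ* M.adjugate) k = 0) : IsPivoted (insert r E) M F where
  det_ne_zero := h.det_ne_zero
  row_mem k hk := Set.mem_insert_of_mem _ (h.row_mem k hk)
  dotProduct_eq_zero k hk := Set.forall_mem_insert.2 ⟨hr k hk, h.dotProduct_eq_zero k hk⟩

theorem IsPivoted.insert_of_dotProduct_ne_zero [IsDomain R] (h : IsPivoted E M F) {r : n → R}
    {p : n} (hp : p ∈ F) (hr : (r ᵥ* M.adjugate) p ≠ 0) :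
    IsPivoted (insert r E) (M.updateRow p r) (F.erase p) where
  det_ne_zero := by rwa [det_updateRow_eq_vecMul_adjugate]
  row_mem k hk := by
    obtain rfl | hkp := eq_or_ne k p
    · rw [Matrix.updateRow_self]
      exact Set.mem_insert _ _
    · rw [Matrix.updateRow_ne hkp]
      exact Set.mem_insert_of_mem _ (h.row_mem k fun hkF => hk (Finset.mem_erase.2 ⟨hkp, hkF⟩))
  dotProduct_eq_zero k hk r' hr' := by
    obtain ⟨hkp, hkF⟩ := Finset.mem_erase.1 hk
    have expand : M.det * (r' ᵥ* (M.updateRow p r).adjugate) k =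
        (r ᵥ* M.adjugate) p * (r' ᵥ* M.adjugate) k -
          (r ᵥ* M.adjugate) k * (r' ᵥ* M.adjugate) p := by
      simp only [Matrix.vecMul, dotProduct, Finset.mul_sum, ← Finset.sum_sub_distrib]
      refine Finset.sum_congr rfl fun x _ => ?_
      have := det_mul_adjugate_updateRow_apply M hkp r x
      simp only [Matrix.vecMul, dotProduct] at this
      linear_combination r' x * this
    refine (mul_eq_zero.1 (expand.trans ?_)).resolve_left h.det_ne_zero
    obtain rfl | hr' := hr'
    · ring
    · rw [h.dotProduct_eq_zero k hkF r' hr', h.dotProduct_eq_zero p hp r' hr']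
      ring

theorem IsPivoted.map {S : Type*} [CommRing S] {f : R →+* S} (hf : Function.Injective f)
    (h : IsPivoted E M F) : IsPivoted ((fun r => f ∘ r) '' E) (M.map f) F where
  det_ne_zero := by
    rw [← RingHom.mapMatrix_apply, ← RingHom.map_det]
    exact (map_ne_zero_iff f hf).2 h.det_ne_zero
  row_mem k hk := ⟨M k, h.row_mem k hk, rfl⟩
  dotProduct_eq_zero k hk := by
    rintro _ ⟨r, hr, rfl⟩
    rw [← RingHom.mapMatrix_apply, ← RingHom.map_adjugate, RingHom.mapMatrix_apply,
      ← RingHom.map_vecMul, h.dotProduct_eq_zero k hk r hr, map_zero]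

end Pivoted

section Field

variable {K m n : Type*} [Field K] [Fintype n] [DecidableEq n]

theorem linearIndependent_col_adjugate {M : Matrix n n K} (hM : M.det ≠ 0) :
    LinearIndependent K M.adjugate.col := by
  rw [Matrix.linearIndependent_cols_iff_isUnit, Matrix.isUnit_iff_isUnit_det, Matrix.det_adjugate]
  exact (pow_ne_zero _ hM).isUnit

theorem IsPivoted.span_col_adjugate {A : Matrix m n K} {M : Matrix n n K} {F : Finset n}
    (h : IsPivoted (Set.range A.row) M F) :
    Submodule.span K (M.adjugate.col '' F) = LinearMap.ker A.mulVecLin := by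
  refine le_antisymm (Submodule.span_le.2 ?_) fun b hb => ?_
  · rintro _ ⟨k, hk, rfl⟩
    ext i
    exact h.dotProduct_eq_zero k hk _ ⟨i, rfl⟩
  · have Ab : A *ᵥ b = 0 := hb
    have expand : M.det • b = ∑ k, (M *ᵥ b) k • M.adjugate.col k := by
      rw [← Matrix.one_mulVec (M.det • b), Matrix.mulVec_smul, ← Matrix.smul_mulVec,
        ← Matrix.adjugate_mul, ← Matrix.mulVec_mulVec, Matrix.mulVec_eq_sum]
      simp only [op_smul_eq_smul]
      rfl
    rw [← Submodule.smul_mem_iff _ h.det_ne_zero, expand]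
    refine Submodule.sum_mem _ fun k _ => ?_
    by_cases hk : k ∈ F
    · exact Submodule.smul_mem _ _ (Submodule.subset_span ⟨k, hk, rfl⟩)
    · obtain ⟨i, hi⟩ := h.row_mem k hk
      have : (M *ᵥ b) k = (A *ᵥ b) i := congrArg (· ⬝ᵥ b) hi.symm
      rw [this, Ab, Pi.zero_apply, zero_smul]
      exact Submodule.zero_mem _

end Field

/-! ### Full null matrices -/

section FullNull

variable {m n k : ℕ} {A : Matrix (Fin m) (Fin n) ℚ} {N : Matrix (Fin n) (Fin k) ℚ}

theorem IsPivoted.isFullNullMatrix {W : Matrix (Fin m) (Fin n) ℤ} {M : Matrix (Fin n) (Fin n) ℤ}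
    {F : Finset (Fin n)} (h : IsPivoted (Set.range W.row) M F) {e : Fin k → Fin n}
    (he : Function.Injective e) (hF : Set.range e = F) :
    IsFullNullMatrix (W.map (Int.cast : ℤ → ℚ)) ((M.adjugate.submatrix id e).map Int.cast) := by
  have hq := h.map (f := Int.castRingHom ℚ) Int.cast_injective
  have col_eq : ((M.adjugate.submatrix id e).map (Int.cast : ℤ → ℚ)).col =
      (M.map (Int.castRingHom ℚ)).adjugate.col ∘ e := by
    rw [← RingHom.mapMatrix_apply, ← RingHom.map_adjugate]
    rfl
  refine ⟨?_, ?_⟩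
  · rw [col_eq]
    exact (linearIndependent_col_adjugate hq.det_ne_zero).comp e he
  · rw [col_eq, Set.range_comp, hF]
    exact IsPivoted.span_col_adjugate (by rwa [← Set.range_comp] at hq)

theorem isFullNullMatrix_smul_iff {D : ℚ} (hD : D ≠ 0) :
    IsFullNullMatrix (D • A) N ↔ IsFullNullMatrix A N := by
  have : LinearMap.ker (D • A).mulVecLin = LinearMap.ker A.mulVecLin := by
    ext b
    simp [hD]
  rw [IsFullNullMatrix, IsFullNullMatrix, this]

theorem isFullNullMatrix_iff : IsFullNullMatrix A N ↔
    Function.Injective N.mulVec ∧ LinearMap.range N.mulVecLin = LinearMap.ker A.mulVecLin := by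
  rw [IsFullNullMatrix, Matrix.mulVec_injective_iff, Matrix.range_mulVecLin]

theorem IsFullNullMatrix.mul_eq_zero (h : IsFullNullMatrix A N) : A * N = 0 := by
  have hker := LinearMap.range_le_ker_iff.1 (isFullNullMatrix_iff.1 h).2.le
  rw [← Matrix.mulVecLin_mul] at hker
  exact Matrix.toLin'.map_eq_zero_iff.1 hker

theorem IsFullNullMatrix.rank_add_eq (h : IsFullNullMatrix A N) : A.rank + k = n := by
  have hk : Module.finrank ℚ (LinearMap.ker A.mulVecLin) = k := by
    rw [← h.2, finrank_span_eq_card h.1, Fintype.card_fin]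
  have := A.mulVecLin.finrank_range_add_finrank_ker
  rwa [hk, Module.finrank_fin_fun] at this

theorem IsFullNullMatrix.transpose (h : IsFullNullMatrix A N) (hA : LinearIndependent ℚ A.row) :
    IsFullNullMatrix Nᵀ Aᵀ := by
  refine ⟨hA, Submodule.eq_of_le_of_finrank_eq ?_ ?_⟩
  · rw [← Matrix.range_mulVecLin, LinearMap.range_le_ker_iff, ← Matrix.mulVecLin_mul,
      ← Matrix.transpose_mul, h.mul_eq_zero, Matrix.transpose_zero, Matrix.mulVecLin_zero]
  · have rank_A : A.rank = m := by simpa using hA.rank_matrix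
    have rank_N : N.rank = k := by
      rw [Matrix.rank_eq_finrank_span_cols, finrank_span_eq_card h.1, Fintype.card_fin]
    have dims := h.rank_add_eq
    have nullity := Nᵀ.mulVecLin.finrank_range_add_finrank_ker
    change Nᵀ.rank + _ = _ at nullity
    rw [Matrix.rank_transpose, rank_N, Module.finrank_fin_fun] at nullity
    have span_A : Module.finrank ℚ (Submodule.span ℚ (Set.range Aᵀ.col)) = m :=
      (finrank_span_eq_card hA).trans (Fintype.card_fin m)
    omega

theorem IsFullNullMatrix.mul_isUnit (h : IsFullNullMatrix A N) {X : Matrix (Fin k) (Fin k) ℚ}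
    (hX : IsUnit X) : IsFullNullMatrix A (N * X) := by
  rw [isFullNullMatrix_iff] at h ⊢
  refine ⟨?_, ?_⟩
  · rw [← Matrix.coe_mulVecLin, Matrix.mulVecLin_mul]
    exact h.1.comp (Matrix.mulVec_injective_of_isUnit hX)
  · rw [Matrix.mulVecLin_mul, LinearMap.range_comp_of_range_eq_top, h.2]
    exact LinearMap.range_eq_top.2 (Matrix.mulVec_surjective_iff_isUnit.2 hX)

theorem IsFullNullMatrix.exists_eq_mul {N' : Matrix (Fin n) (Fin k) ℚ}
    (h : IsFullNullMatrix A N) (h' : IsFullNullMatrix A N') :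
    ∃ X : Matrix (Fin k) (Fin k) ℚ, IsUnit X ∧ N' = N * X := by
  have col_mem (j : Fin k) : ∃ x, N *ᵥ x = N'.col j := by
    have : N'.col j ∈ LinearMap.range N.mulVecLin := by
      rw [Matrix.range_mulVecLin, h.2, ← h'.2]
      exact Submodule.subset_span ⟨j, rfl⟩
    exact this
  choose x hx using col_mem
  have N'_eq : N' = N * (Matrix.of x)ᵀ := by
    ext i j
    exact (congrFun (hx j) i).symm
  refine ⟨(Matrix.of x)ᵀ, Matrix.mulVec_injective_iff_isUnit.1 ?_, N'_eq⟩
  have N'_injective := (isFullNullMatrix_iff.1 h').1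
  rw [N'_eq, ← Matrix.coe_mulVecLin, Matrix.mulVecLin_mul, LinearMap.coe_comp] at N'_injective
  exact N'_injective.of_comp

theorem fullRank_of_mem_sparseNullSpace {A N : RatMatrix} (h : N ∈ sparseNullSpace.S A) :
    N.FullRank := by
  obtain ⟨k, N₀, rfl, hN₀⟩ := h
  exact hN₀.1

theorem sparseNullSpace_S_eq_matrixSparsification_S {A N : RatMatrix}
    (h : N ∈ sparseNullSpace.S A) (hN : N.FullRank) :
    sparseNullSpace.S A = matrixSparsification.S ⟨N, hN⟩ := by
  obtain ⟨k, N₀, rfl, hN₀⟩ := h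
  ext P
  constructor
  · rintro ⟨k', P₀, rfl, hP₀⟩
    obtain rfl : k' = k := by have := hN₀.rank_add_eq; have := hP₀.rank_add_eq; omega
    obtain ⟨X, hX, rfl⟩ := hN₀.exists_eq_mul hP₀
    exact ⟨X, hX, rfl⟩
  · rintro ⟨X, hX, rfl⟩
    exact ⟨k, N₀ * X, rfl, hN₀.mul_isUnit hX⟩

end FullNull

/-! ### Program logic -/

instance : Add Exp := ⟨Exp.add⟩

instance : Sub Exp := ⟨Exp.sub⟩

instance : Mul Exp := ⟨Exp.mul⟩

instance : Div Exp := ⟨Exp.div⟩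

instance (n : ℕ) : OfNat Exp n := ⟨Exp.const n⟩

section Eval

variable (s : Store) (e₁ e₂ : Exp)

@[simp] theorem Exp.eval_var (x : ℕ) : (Exp.var x).eval s = s.var x := rfl

@[simp] theorem Exp.eval_read (a : ℕ) : (Exp.read a e₁).eval s = s.arr a (e₁.eval s) := rfl

@[simp] theorem Exp.eval_add : (e₁ + e₂).eval s = e₁.eval s + e₂.eval s := rfl

@[simp] theorem Exp.eval_sub : (e₁ - e₂).eval s = e₁.eval s - e₂.eval s := rfl

@[simp] theorem Exp.eval_mul : (e₁ * e₂).eval s = e₁.eval s * e₂.eval s := rfl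

@[simp] theorem Exp.eval_div : (e₁ / e₂).eval s = e₁.eval s / e₂.eval s := rfl

@[simp] theorem Exp.eval_zero : (0 : Exp).eval s = 0 := rfl

@[simp] theorem Exp.eval_one : (1 : Exp).eval s = 1 := rfl

@[simp] theorem Exp.eval_ofNat (n : ℕ) [n.AtLeastTwo] :
    (ofNat(n) : Exp).eval s = (ofNat(n) : ℤ) := rfl

end Eval

local infix:40 " ::= " => Prog.assign

local infixr:35 " ;; " => Prog.seq

/-- The store after an assignment to a variable. -/
def Store.setVar (s : Store) (x : ℕ) (v : ℤ) : Store :=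
  { s with var := Function.update s.var x v }

/-- The store after an assignment to an array cell. -/
def Store.setArr (s : Store) (a : ℕ) (i v : ℤ) : Store :=
  { s with arr := Function.update s.arr a (Function.update (s.arr a) i v) }

@[simp] theorem Store.var_setVar (s : Store) (x y : ℕ) (v : ℤ) :
    (s.setVar x v).var y = if y = x then v else s.var y :=
  Function.update_apply ..

@[simp] theorem Store.arr_setVar (s : Store) (x : ℕ) (v : ℤ) : (s.setVar x v).arr = s.arr := rfl

@[simp] theorem Store.var_setArr (s : Store) (a : ℕ) (i v : ℤ) : (s.setArr a i v).var = s.var := rfl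

@[simp] theorem Store.arr_setArr (s : Store) (a b : ℕ) (i v : ℤ) :
    (s.setArr a i v).arr b = if b = a then Function.update (s.arr a) i v else s.arr b :=
  Function.update_apply ..

/-- All values in the store have absolute value at most `2 ^ N`. -/
structure Store.Bounded (N : ℕ) (s : Store) : Prop where
  abs_var_le : ∀ x, |s.var x| ≤ 2 ^ N
  abs_arr_le : ∀ a i, |s.arr a i| ≤ 2 ^ N

theorem Store.Bounded.setVar {N : ℕ} {s : Store} (h : s.Bounded N) {x : ℕ} {v : ℤ}
    (hv : |v| ≤ 2 ^ N) : (s.setVar x v).Bounded N where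
  abs_var_le y := by
    rw [Store.var_setVar]
    split_ifs
    exacts [hv, h.abs_var_le y]
  abs_arr_le := h.abs_arr_le

theorem Store.Bounded.setArr {N : ℕ} {s : Store} (h : s.Bounded N) {a : ℕ} {i v : ℤ}
    (hv : |v| ≤ 2 ^ N) : (s.setArr a i v).Bounded N where
  abs_var_le := h.abs_var_le
  abs_arr_le b j := by
    rw [Store.arr_setArr]
    split_ifs
    · rw [Function.update_apply]
      split_ifs
      exacts [hv, h.abs_arr_le a j]
    · exact h.abs_arr_le b j

/-- A size of expressions that controls the bit lengths of their values: evaluation multiplies bit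
lengths by at most this factor. -/
def Exp.weight : Exp → ℕ
  | const z => z.natAbs + 1
  | var _ => 1
  | read _ i => i.weight + 1
  | add e₁ e₂ => e₁.weight + e₂.weight + 1
  | sub e₁ e₂ => e₁.weight + e₂.weight + 1
  | mul e₁ e₂ => e₁.weight + e₂.weight + 1
  | div e₁ e₂ => e₁.weight + e₂.weight + 1

theorem abs_ediv_le_abs (a b : ℤ) : |a / b| ≤ |a| := by
  rw [Int.abs_eq_natAbs, Int.abs_eq_natAbs]
  exact_mod_cast Int.natAbs_ediv_le_natAbs a b

theorem Exp.abs_eval_le {N : ℕ} {s : Store} (hs : s.Bounded N) (e : Exp) :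
    |e.eval s| ≤ 2 ^ ((N + 1) * e.weight) := by
  have two_pow_mono {a b : ℕ} (h : a ≤ b) : (2 : ℤ) ^ a ≤ 2 ^ b :=
    pow_le_pow_right₀ one_le_two h
  have abs_add_abs_le {x y : ℤ} {a b : ℕ} (hx : |x| ≤ 2 ^ ((N + 1) * a))
      (hy : |y| ≤ 2 ^ ((N + 1) * b)) : |x| + |y| ≤ 2 ^ ((N + 1) * (a + b + 1)) :=
    calc |x| + |y|
      _ ≤ 2 ^ ((N + 1) * (a + b)) + 2 ^ ((N + 1) * (a + b)) :=
        add_le_add (hx.trans (two_pow_mono (by gcongr; omega)))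
          (hy.trans (two_pow_mono (by gcongr; omega)))
      _ = 2 ^ ((N + 1) * (a + b) + 1) := by ring
      _ ≤ _ := two_pow_mono (by rw [mul_add (N + 1) (a + b)]; omega)
  induction e with
  | const z =>
    calc |z| = (z.natAbs : ℤ) := Int.abs_eq_natAbs z
      _ ≤ 2 ^ z.natAbs := by exact_mod_cast Nat.lt_two_pow_self.le
      _ ≤ _ := two_pow_mono ((Nat.le_succ _).trans (Nat.le_mul_of_pos_left _ N.succ_pos))
  | var x => exact (hs.abs_var_le x).trans (two_pow_mono (by simp [Exp.weight]))
  | read a i _ =>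
    exact (hs.abs_arr_le a _).trans (two_pow_mono (by simp only [Exp.weight]; nlinarith))
  | add e₁ e₂ h₁ h₂ => exact (abs_add_le _ _).trans (abs_add_abs_le h₁ h₂)
  | sub e₁ e₂ h₁ h₂ => exact (abs_sub _ _).trans (abs_add_abs_le h₁ h₂)
  | mul e₁ e₂ h₁ h₂ =>
    calc |e₁.eval s * e₂.eval s|
      _ ≤ 2 ^ ((N + 1) * e₁.weight) * 2 ^ ((N + 1) * e₂.weight) := by rw [abs_mul]; gcongr
      _ = 2 ^ ((N + 1) * (e₁.weight + e₂.weight)) := by rw [← pow_add, mul_add]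
      _ ≤ _ := two_pow_mono (Nat.mul_le_mul_left _ (Nat.le_succ _))
  | div e₁ e₂ h₁ _ =>
    refine (abs_ediv_le_abs _ _).trans (h₁.trans (two_pow_mono ?_))
    simp only [Exp.weight]
    gcongr
    omega

theorem bitLen_le {z : ℤ} {n : ℕ} (h : |z| ≤ 2 ^ n) : bitLen z ≤ n + 2 := by
  have natAbs_le : z.natAbs ≤ 2 ^ n := by
    rw [Int.abs_eq_natAbs] at h
    exact_mod_cast h
  have := Nat.size_le.2 (natAbs_le.trans_lt (Nat.pow_lt_pow_succ one_lt_two))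
  rw [bitLen]
  omega

/-- A bound for the cost of evaluating an expression in a store bounded by `2 ^ N`. -/
def Exp.time (N : ℕ) (e : Exp) : ℕ := e.weight * ((N + 1) * e.weight + 2)

theorem Exp.cost_le_time {N : ℕ} {s : Store} (hs : s.Bounded N) (e : Exp) :
    e.cost s ≤ e.time N := by
  have bitLen_eval_le (e : Exp) := bitLen_le (e.abs_eval_le hs)
  induction e with
  | const z => exact (bitLen_eval_le (.const z)).trans (Nat.le_mul_of_pos_left _ z.natAbs.succ_pos)
  | var x => exact (bitLen_eval_le (.var x)).trans (Nat.le_mul_of_pos_left _ one_pos)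
  | read a i ih =>
    have := bitLen_eval_le (.read a i)
    simp only [Exp.time, Exp.cost, Exp.weight, Exp.eval] at *
    nlinarith
  | add e₁ e₂ h₁ h₂ =>
    have := bitLen_eval_le (.add e₁ e₂)
    simp only [Exp.time, Exp.cost, Exp.weight, Exp.eval] at *
    nlinarith [Nat.zero_le ((N + 1) * (e₁.weight * e₂.weight))]
  | sub e₁ e₂ h₁ h₂ =>
    have := bitLen_eval_le (.sub e₁ e₂)
    simp only [Exp.time, Exp.cost, Exp.weight, Exp.eval] at *
    nlinarith [Nat.zero_le ((N + 1) * (e₁.weight * e₂.weight))]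
  | mul e₁ e₂ h₁ h₂ =>
    have := bitLen_eval_le (.mul e₁ e₂)
    simp only [Exp.time, Exp.cost, Exp.weight, Exp.eval] at *
    nlinarith [Nat.zero_le ((N + 1) * (e₁.weight * e₂.weight))]
  | div e₁ e₂ h₁ h₂ =>
    have := bitLen_eval_le (.div e₁ e₂)
    simp only [Exp.time, Exp.cost, Exp.weight, Exp.eval] at *
    nlinarith [Nat.zero_le ((N + 1) * (e₁.weight * e₂.weight))]

/-- A bound for the cost of a program that keeps its store bounded by `2 ^ N` and iterates each of
its loops at most `N` times per entry. -/
def Prog.time (N : ℕ) : Prog → ℕ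
  | skip => 1
  | assign _ e => e.time N + 1
  | write _ i e => i.time N + e.time N + 1
  | seq c₁ c₂ => c₁.time N + c₂.time N
  | ite e c₁ c₂ => e.time N + 1 + (c₁.time N + c₂.time N)
  | loop e c => N * (e.time N + 1 + c.time N) + (e.time N + 1)

theorem Prog.exists_polynomial_eval_eq_time (c : Prog) :
    ∃ p : Polynomial ℕ, ∀ N, p.eval N = c.time N := by
  have exp_time (e : Exp) : ∃ p : Polynomial ℕ, ∀ N, p.eval N = e.time N :=
    ⟨.C e.weight * ((.X + 1) * .C e.weight + 2), fun N => by simp [Exp.time]⟩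
  induction c with
  | skip => exact ⟨1, fun N => by simp [Prog.time]⟩
  | assign x e =>
    obtain ⟨p, hp⟩ := exp_time e
    exact ⟨p + 1, fun N => by simp [Prog.time, hp]⟩
  | write a i e =>
    obtain ⟨p, hp⟩ := exp_time i
    obtain ⟨q, hq⟩ := exp_time e
    exact ⟨p + q + 1, fun N => by simp [Prog.time, hp, hq]⟩
  | seq c₁ c₂ h₁ h₂ =>
    obtain ⟨p, hp⟩ := h₁
    obtain ⟨q, hq⟩ := h₂
    exact ⟨p + q, fun N => by simp [Prog.time, hp, hq]⟩
  | ite e c₁ c₂ h₁ h₂ =>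
    obtain ⟨r, hr⟩ := exp_time e
    obtain ⟨p, hp⟩ := h₁
    obtain ⟨q, hq⟩ := h₂
    exact ⟨r + 1 + (p + q), fun N => by simp [Prog.time, hp, hq, hr]⟩
  | loop e c h =>
    obtain ⟨r, hr⟩ := exp_time e
    obtain ⟨p, hp⟩ := h
    exact ⟨.X * (r + 1 + p) + (r + 1), fun N => by simp [Prog.time, hp, hr]⟩

/-- The variables assigned by a program. -/
def Prog.modVars : Prog → List ℕ
  | skip => []
  | assign x _ => [x]
  | write _ _ _ => []
  | seq c₁ c₂ => c₁.modVars ++ c₂.modVars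
  | ite _ c₁ c₂ => c₁.modVars ++ c₂.modVars
  | loop _ c => c.modVars

/-- The arrays written by a program. -/
def Prog.modArrs : Prog → List ℕ
  | skip => []
  | assign _ _ => []
  | write a _ _ => [a]
  | seq c₁ c₂ => c₁.modArrs ++ c₂.modArrs
  | ite _ c₁ c₂ => c₁.modArrs ++ c₂.modArrs
  | loop _ c => c.modArrs

/-- The stores `s` and `s'` agree on all variables and arrays that `c` does not modify. -/
structure Prog.Frame (c : Prog) (s s' : Store) : Prop where
  var_eq : ∀ x, x ∉ c.modVars → s'.var x = s.var x
  arr_eq : ∀ a, a ∉ c.modArrs → s'.arr a = s.arr a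

namespace Prog.Frame

variable {c c' : Prog} {s s' s'' : Store}

theorem refl (c : Prog) (s : Store) : c.Frame s s := ⟨fun _ _ => rfl, fun _ _ => rfl⟩

theorem trans (h : c.Frame s s') (h' : c.Frame s' s'') : c.Frame s s'' where
  var_eq x hx := (h'.var_eq x hx).trans (h.var_eq x hx)
  arr_eq a ha := (h'.arr_eq a ha).trans (h.arr_eq a ha)

theorem mono (h : c.Frame s s') (hv : c.modVars ⊆ c'.modVars) (ha : c.modArrs ⊆ c'.modArrs) :
    c'.Frame s s' where
  var_eq x hx := h.var_eq x fun hx' => hx (hv hx')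
  arr_eq a ha' := h.arr_eq a fun hx' => ha' (ha hx')

theorem seq_left (h : c.Frame s s') : (c ;; c').Frame s s' :=
  h.mono (List.subset_append_left _ _) (List.subset_append_left _ _)

theorem seq_right (h : c'.Frame s s') : (c ;; c').Frame s s' :=
  h.mono (List.subset_append_right _ _) (List.subset_append_right _ _)

end Prog.Frame

theorem Exec.frame {c : Prog} {s s' : Store} {t : ℕ} (h : Exec c s s' t) : c.Frame s s' := by
  induction h with
  | skip s => exact .refl _ _
  | assign x e s =>
    refine ⟨fun y hy => ?_, fun _ _ => rfl⟩
    exact Function.update_of_ne (by simpa [Prog.modVars] using hy) _ _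
  | write a i e s =>
    refine ⟨fun _ _ => rfl, fun b hb => ?_⟩
    exact Function.update_of_ne (by simpa [Prog.modArrs] using hb) _ _
  | seq _ _ ih₁ ih₂ => exact ih₁.seq_left.trans ih₂.seq_right
  | ite_pos _ _ ih =>
    exact ih.mono (List.subset_append_left _ _) (List.subset_append_left _ _)
  | ite_neg _ _ ih =>
    exact ih.mono (List.subset_append_right _ _) (List.subset_append_right _ _)
  | loop_pos _ _ _ ih₁ ih₂ =>
    exact Prog.Frame.trans (c := .loop _ _) ⟨ih₁.var_eq, ih₁.arr_eq⟩ ih₂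
  | loop_neg _ => exact .refl _ _

/-- Total correctness with resource bounds: started in the store `s`, if it is bounded by `2 ^ N`,
the program `c` halts within cost `c.time N` in a store with property `Q` that is again bounded by
`2 ^ N`. -/
def Runs (N : ℕ) (c : Prog) (s : Store) (Q : Store → Prop) : Prop :=
  s.Bounded N → ∃ s' t, Exec c s s' t ∧ t ≤ c.time N ∧ s'.Bounded N ∧ Q s'

namespace Runs

variable {N : ℕ} {s : Store} {Q Q' : Store → Prop} {c c₁ c₂ : Prog}

theorem mono (h : Runs N c s Q) (hQ : ∀ s', c.Frame s s' → Q s' → Q' s') : Runs N c s Q' := by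
  intro hs
  obtain ⟨s', t, exec, ht, bounded, hQs'⟩ := h hs
  exact ⟨s', t, exec, ht, bounded, hQ s' exec.frame hQs'⟩

theorem of_bounded (h : s.Bounded N → Runs N c s Q) : Runs N c s Q := fun hs => h hs hs

theorem skip (hQ : Q s) : Runs N .skip s Q := fun hs => ⟨s, 1, .skip s, le_rfl, hs, hQ⟩

theorem assign {x : ℕ} {e : Exp} (he : |e.eval s| ≤ 2 ^ N) (hQ : Q (s.setVar x (e.eval s))) :
    Runs N (x ::= e) s Q := fun hs =>
  ⟨_, _, .assign x e s, Nat.succ_le_succ (e.cost_le_time hs), hs.setVar he, hQ⟩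

theorem write {a : ℕ} {i e : Exp} (he : |e.eval s| ≤ 2 ^ N)
    (hQ : Q (s.setArr a (i.eval s) (e.eval s))) : Runs N (.write a i e) s Q := fun hs =>
  ⟨_, _, .write a i e s,
    Nat.succ_le_succ (add_le_add (i.cost_le_time hs) (e.cost_le_time hs)), hs.setArr he, hQ⟩

theorem seq (h : Runs N c₁ s fun s' => Runs N c₂ s' Q) : Runs N (c₁ ;; c₂) s Q := by
  intro hs
  obtain ⟨s₁, t₁, exec₁, ht₁, bounded₁, h₂⟩ := h hs
  obtain ⟨s₂, t₂, exec₂, ht₂, bounded₂, hQ⟩ := h₂ bounded₁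
  exact ⟨s₂, _, .seq exec₁ exec₂, add_le_add ht₁ ht₂, bounded₂, hQ⟩

theorem ite {e : Exp} (h₁ : 0 < e.eval s → Runs N c₁ s Q) (h₂ : ¬ 0 < e.eval s → Runs N c₂ s Q) :
    Runs N (.ite e c₁ c₂) s Q := by
  intro hs
  have he := e.cost_le_time hs
  by_cases h : 0 < e.eval s
  · obtain ⟨s', t, exec, ht, hs'⟩ := h₁ h hs
    exact ⟨s', _, .ite_pos h exec, by rw [Prog.time]; omega, hs'⟩
  · obtain ⟨s', t, exec, ht, hs'⟩ := h₂ h hs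
    exact ⟨s', _, .ite_neg h exec, by rw [Prog.time]; omega, hs'⟩

theorem loop {e : Exp} {n : ℕ} (hn : n ≤ N) (I : ℕ → Store → Prop) (zero : I 0 s)
    (step : ∀ i < n, ∀ s', c.Frame s s' → I i s' → 0 < e.eval s' ∧ Runs N c s' (I (i + 1)))
    (exit : ∀ s', c.Frame s s' → I n s' → ¬ 0 < e.eval s') : Runs N (.loop e c) s (I n) := by
  have remaining (j : ℕ) : ∀ i s', i + j = n → c.Frame s s' → I i s' → s'.Bounded N →
      ∃ s'' t, Exec (.loop e c) s' s'' t ∧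
        t ≤ j * (e.time N + 1 + c.time N) + (e.time N + 1) ∧ s''.Bounded N ∧ I n s'' := by
    induction j with
    | zero =>
      rintro i s' rfl hF hI hs
      have he := e.cost_le_time hs
      exact ⟨s', _, .loop_neg (exit s' hF hI), by omega, hs, hI⟩
    | succ j ih =>
      intro i s' hij hF hI hs
      have he := e.cost_le_time hs
      obtain ⟨he_pos, body⟩ := step i (by omega) s' hF hI
      obtain ⟨s₁, t₁, exec₁, ht₁, bounded₁, hI₁⟩ := body hs
      obtain ⟨s₂, t₂, exec₂, ht₂, h₂⟩ :=
        ih (i + 1) s₁ (by omega) (hF.trans exec₁.frame) hI₁ bounded₁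
      exact ⟨s₂, _, .loop_pos he_pos exec₁ exec₂, by rw [add_one_mul]; omega, h₂⟩
  intro hs
  obtain ⟨s', t, exec, ht, h⟩ := remaining n 0 s (by omega) (.refl _ _) zero hs
  refine ⟨s', t, exec, ht.trans ?_, h⟩
  rw [Prog.time]
  gcongr

end Runs

theorem natCast_le_two_pow {n N : ℕ} (h : n ≤ N) : (n : ℤ) ≤ 2 ^ N := by
  exact_mod_cast h.trans Nat.lt_two_pow_self.le

theorem abs_natCast_le_two_pow {n N : ℕ} (h : n ≤ N) : |(n : ℤ)| ≤ 2 ^ N := by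
  rw [Nat.abs_cast]
  exact natCast_le_two_pow h

/-- `for x = 0, …, y - 1 do c`. -/
def forLoop (x y : ℕ) (c : Prog) : Prog :=
  x ::= 0 ;; .loop (.var y - .var x) (c ;; x ::= .var x + 1)

theorem Runs.forLoop {N : ℕ} {x y : ℕ} {c : Prog} {s : Store} {Q : Store → Prop} {n : ℕ}
    (hn : s.var y = n) (hnN : n ≤ N) (hx : x ∉ c.modVars) (hy : y ∉ x :: c.modVars)
    (I : ℕ → Store → Prop) (hI : ∀ i s' v, I i s' → I i (s'.setVar x v)) (zero : I 0 s)
    (step : ∀ i : Fin n, ∀ s', (SparseMat.forLoop x y c).Frame s s' → s'.var x = i → I i s' →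
      Runs N c s' (I (i + 1)))
    (done : ∀ s', (SparseMat.forLoop x y c).Frame s s' → I n s' → Q s') :
    Runs N (SparseMat.forLoop x y c) s Q := by
  obtain ⟨hyx, hyc⟩ : y ≠ x ∧ y ∉ c.modVars := by simpa using hy
  refine Runs.mono (Q := I n) (.seq (.assign (by simp) ?_)) done
  have bound_eq {s'} (hF : (c ;; x ::= .var x + 1).Frame (s.setVar x 0) s') : s'.var y = n := by
    rw [hF.var_eq y (by simp [Prog.modVars, hyx, hyc]), ← hn]
    simp [hyx]
  refine (Runs.loop hnN (fun i s' => s'.var x = i ∧ I i s') ⟨by simp, hI _ _ _ zero⟩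
    ?_ ?_).mono fun s' _ h => h.2
  · rintro i hi s' hF ⟨hxi, hIi⟩
    have frame : (SparseMat.forLoop x y c).Frame s s' :=
      Prog.Frame.trans (Exec.assign x 0 s).frame.seq_left
        (.seq_right ⟨hF.var_eq, hF.arr_eq⟩)
    refine ⟨by simp [bound_eq hF, hxi, hi], .seq ?_⟩
    refine (step ⟨i, hi⟩ s' frame hxi hIi).mono fun s'' hF' hI' => ?_
    have hxi' : s''.var x = i := by rw [hF'.var_eq x hx, hxi]
    refine .assign ?_ ⟨by simp [hxi'], hI _ _ _ hI'⟩
    simpa [hxi'] using abs_natCast_le_two_pow (Nat.succ_le_of_lt (hi.trans_le hnN))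
  · rintro s' hF ⟨hxi, -⟩
    simp [bound_eq hF, hxi]

namespace Reg

/-! Variables of the programs below; input and output fix the meaning of `outLen`. -/

abbrev outLen : ℕ := 0
abbrev rows : ℕ := 1
abbrev cols : ℕ := 2
abbrev denom : ℕ := 3
abbrev z : ℕ := 4
abbrev size : ℕ := 5
abbrev width : ℕ := 6
abbrev i : ℕ := 7
abbrev j : ℕ := 8
abbrev acc : ℕ := 9
abbrev x : ℕ := 10
abbrev r : ℕ := 11
abbrev pivot : ℕ := 12
abbrev det : ℕ := 13
abbrev freeCount : ℕ := 14
abbrev offset : ℕ := 15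

end Reg

namespace Arr

abbrev io : ℕ := 0
abbrev mat : ℕ := 1
abbrev adj : ℕ := 2
abbrev flag : ℕ := 3
abbrev prod : ℕ := 4
abbrev free : ℕ := 5
abbrev tmp : ℕ := 6

end Arr

/-! ### Matrices and lists in memory -/

/-- The array `f` holds the matrix `M` row by row. -/
def HoldsMatrix {p q : ℕ} (f : ℤ → ℤ) (M : Matrix (Fin p) (Fin q) ℤ) : Prop :=
  ∀ (i : Fin p) (j : Fin q), f ((i : ℕ) * q + (j : ℕ)) = M i j

theorem holdsMatrix_iff {p q : ℕ} {f : ℤ → ℤ} {M : Matrix (Fin p) (Fin q) ℤ} :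
    HoldsMatrix f M ↔ ∀ z : Fin (p * q), f (z : ℕ) = M z.divNat z.modNat := by
  refine ⟨fun h z => ?_, fun h i j => ?_⟩
  · rw [← h, Fin.coe_divNat, Fin.coe_modNat]
    exact_mod_cast congrArg (fun n : ℕ => f n) (Nat.div_add_mod' z q).symm
  · have hz := h (finProdFinEquiv (i, j))
    have hij := finProdFinEquiv.symm_apply_apply (i, j)
    rw [finProdFinEquiv_symm_apply, Prod.mk.injEq] at hij
    rw [hij.1, hij.2] at hz
    rw [← hz]
    simp [add_comm, mul_comm]

/-- Write what `body` leaves in `acc` to the cell `z` of the auxiliary array, where `body` finds the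
row and the column of this cell in `i` and `j`. -/
def tabulateCell (body : Prog) : Prog :=
  Reg.i ::= .var Reg.z / .var Reg.width ;; Reg.j ::= .var Reg.z - .var Reg.i * .var Reg.width ;;
  body ;; .write Arr.tmp (.var Reg.z) (.var Reg.acc)

/-- Fill the auxiliary array with the `h × w` matrix whose `(i, j)` entry is what `body` leaves in
`acc`. -/
def tabulateTmp (h w : Exp) (body : Prog) : Prog :=
  Reg.width ::= w ;; Reg.size ::= h * .var Reg.width ;;
  forLoop Reg.z Reg.size (tabulateCell body)

/-- Replace the array `dst` by an `h × w` matrix. All entries are computed before the first one is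
written, so that `body` can read `dst`. -/
def tabulate (dst : ℕ) (h w : Exp) (body : Prog) : Prog :=
  tabulateTmp h w body ;;
  forLoop Reg.z Reg.size (.write dst (.var Reg.z) (.read Arr.tmp (.var Reg.z)))

theorem Prog.Frame.setVar {c : Prog} {s s' : Store} (h : c.Frame s s') {x : ℕ} (v : ℤ)
    (hx : x ∈ c.modVars) : c.Frame s (s'.setVar x v) where
  var_eq y hy := by rw [Store.var_setVar, if_neg (ne_of_mem_of_not_mem hx hy).symm, h.var_eq y hy]
  arr_eq := h.arr_eq

theorem Runs.tabulateCell {N : ℕ} {s : Store} {body : Prog} {p q : ℕ}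
    (M : Matrix (Fin p) (Fin q) ℤ) (hq : q ≤ N) (hpq : p * q ≤ N) (hwidth : s.var Reg.width = q)
    {z : Fin (p * q)} (hz : s.var Reg.z = (z : ℕ)) (hz_mem : Reg.z ∉ body.modVars)
    (htmp : Arr.tmp ∉ body.modArrs)
    (hbody : Runs N body ((s.setVar Reg.i (z.divNat : ℕ)).setVar Reg.j (z.modNat : ℕ))
      fun s' => s'.var Reg.acc = M z.divNat z.modNat) :
    Runs N (SparseMat.tabulateCell body) s fun s' =>
      s'.arr Arr.tmp = Function.update (s.arr Arr.tmp) (z : ℕ) (M z.divNat z.modNat) := by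
  have abs_le {k : ℕ} (hk : k ≤ N) := abs_natCast_le_two_pow hk
  have hmod : ((z : ℕ) : ℤ) - (z.divNat : ℕ) * q = (z.modNat : ℕ) := by
    rw [Fin.coe_divNat, Fin.coe_modNat, Int.natCast_div, Int.natCast_mod, Int.emod_def,
      mul_comm (q : ℤ)]
  have hi : (Exp.var Reg.z / Exp.var Reg.width).eval s = (z.divNat : ℕ) := by simp [hz, hwidth]
  have hj : (Exp.var Reg.z - Exp.var Reg.i * Exp.var Reg.width).eval
      (s.setVar Reg.i (z.divNat : ℕ)) = (z.modNat : ℕ) := by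
    simpa [hz, hwidth] using hmod
  refine .seq (.assign ?_ (.seq (.assign ?_ (.seq ?_)))) <;> rw [hi]
  · exact abs_le (((Nat.div_le_self _ _).trans z.2.le).trans hpq)
  · rw [hj]
    exact abs_le (z.modNat.2.le.trans hq)
  rw [hj]
  refine hbody.mono fun s' hF hacc => .of_bounded fun hs' => .write (hs'.abs_var_le _) ?_
  have hz' : s'.var Reg.z = (z : ℕ) := by rw [hF.var_eq _ hz_mem]; simpa using hz
  rw [Store.arr_setArr, if_pos rfl, Exp.eval_var, Exp.eval_var, hz', hacc, hF.arr_eq _ htmp]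
  rfl

theorem Runs.tabulateTmp {N : ℕ} {s : Store} {h w : Exp} {body : Prog} {p q : ℕ}
    (M : Matrix (Fin p) (Fin q) ℤ) (hq : q ≤ N) (hpq : p * q ≤ N) (hw : w.eval s = q)
    (hh : h.eval (s.setVar Reg.width q) = p)
    (hz : Reg.z ∉ body.modVars) (hsize : Reg.size ∉ body.modVars)
    (hwidth : Reg.width ∉ body.modVars) (htmp : Arr.tmp ∉ body.modArrs)
    (hbody : ∀ (i : Fin p) (j : Fin q) s', (SparseMat.tabulateTmp h w body).Frame s s' →
      s'.var Reg.i = (i : ℕ) → s'.var Reg.j = (j : ℕ) →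
      Runs N body s' fun s'' => s''.var Reg.acc = M i j) :
    Runs N (SparseMat.tabulateTmp h w body) s fun s' =>
      s'.var Reg.size = (p * q : ℕ) ∧ HoldsMatrix (s'.arr Arr.tmp) M := by
  have mem_modVars {x : ℕ} (hx : x ∈ [Reg.width, Reg.size, Reg.z, Reg.i, Reg.j]) :
      x ∈ (SparseMat.tabulateTmp h w body).modVars := by
    simp only [List.mem_cons, List.not_mem_nil, or_false] at hx
    rcases hx with rfl | rfl | rfl | rfl | rfl <;>
      simp [SparseMat.tabulateTmp, SparseMat.tabulateCell, SparseMat.forLoop, Prog.modVars]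
  refine .seq (.assign (by rw [hw]; exact abs_natCast_le_two_pow hq) (.seq (.assign ?_ ?_)))
  · rw [Exp.eval_mul, Exp.eval_var, hw, hh]
    simpa using abs_natCast_le_two_pow hpq
  refine Runs.forLoop (n := p * q) (by simp [hw, hh]) hpq
    (by simp [SparseMat.tabulateCell, Prog.modVars, hz])
    (by simp [SparseMat.tabulateCell, Prog.modVars, hsize])
    (fun i s' => ∀ z : Fin (p * q), (z : ℕ) < i → s'.arr Arr.tmp (z : ℕ) = M z.divNat z.modNat)
    (fun _ _ _ h => h) (by simp) ?_
    fun s' hF h => ⟨?_, holdsMatrix_iff.2 fun z => h z z.2⟩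
  · intro z s' hF hz' hI
    have hwidth' : s'.var Reg.width = q := by
      rw [hF.var_eq _ (by simp [SparseMat.forLoop, SparseMat.tabulateCell, Prog.modVars, hwidth])]
      simp [hw]
    have frame : (SparseMat.tabulateTmp h w body).Frame s s' :=
      (((Prog.Frame.refl _ s).setVar _ (mem_modVars (by simp))).setVar _
        (mem_modVars (by simp))).trans hF.seq_right.seq_right
    refine (Runs.tabulateCell M hq hpq hwidth' hz' hz htmp (hbody z.divNat z.modNat _
      ((frame.setVar _ (mem_modVars (by simp))).setVar _ (mem_modVars (by simp)))
      (by simp) (by simp))).mono fun s'' _ htmp'' k hk => ?_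
    rw [htmp'', Function.update_apply]
    split_ifs with hkz
    · obtain rfl : k = z := Fin.ext (by exact_mod_cast hkz)
      rfl
    · exact hI k (lt_of_le_of_ne (Nat.lt_succ_iff.1 hk) (by exact_mod_cast hkz))
  · rw [hF.var_eq _ (by simp [SparseMat.forLoop, SparseMat.tabulateCell, Prog.modVars, hsize])]
    simp [hw, hh]

theorem Runs.tabulate {N : ℕ} {s : Store} {dst : ℕ} {h w : Exp} {body : Prog} {p q : ℕ}
    {M : Matrix (Fin p) (Fin q) ℤ} (hq : q ≤ N) (hpq : p * q ≤ N) (hw : w.eval s = q)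
    (hh : h.eval (s.setVar Reg.width q) = p)
    (hbody : ∀ (i : Fin p) (j : Fin q) s', (SparseMat.tabulateTmp h w body).Frame s s' →
      s'.var Reg.i = (i : ℕ) → s'.var Reg.j = (j : ℕ) →
      Runs N body s' fun s'' => s''.var Reg.acc = M i j)
    (hz : Reg.z ∉ body.modVars := by decide) (hsize : Reg.size ∉ body.modVars := by decide)
    (hwidth : Reg.width ∉ body.modVars := by decide) (htmp : Arr.tmp ∉ body.modArrs := by decide)
    (hdst : Arr.tmp ≠ dst := by decide) :
    Runs N (SparseMat.tabulate dst h w body) s fun s' => HoldsMatrix (s'.arr dst) M := by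
  refine .seq ((Runs.tabulateTmp M hq hpq hw hh hz hsize hwidth htmp hbody).mono ?_)
  rintro s' - ⟨hsize', hM⟩
  refine Runs.forLoop hsize' hpq (by simp [Prog.modVars]) (by simp [Prog.modVars])
    (fun i s' => ∀ z : Fin (p * q), (z : ℕ) < i → s'.arr dst (z : ℕ) = M z.divNat z.modNat)
    (fun _ _ _ h => h) (by simp) ?_ fun s' _ h => holdsMatrix_iff.2 fun z => h z z.2
  refine fun z s'' hF hz' hI => .of_bounded fun hs'' => .write (hs''.abs_arr_le _ _) fun k hk => ?_
  have htmp'' : s''.arr Arr.tmp = s'.arr Arr.tmp :=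
    hF.arr_eq _ (by simp [SparseMat.forLoop, Prog.modArrs, hdst])
  rw [Store.arr_setArr, if_pos rfl, Exp.eval_read, Exp.eval_var, hz', htmp'',
    Function.update_apply]
  split_ifs with hkz
  · obtain rfl : k = z := Fin.ext (by exact_mod_cast hkz)
    exact holdsMatrix_iff.1 hM k
  · exact hI k (lt_of_le_of_ne (Nat.lt_succ_iff.1 hk) (by exact_mod_cast hkz))

/-- The word `w` stands in the array `a` at the addresses `0, 1, …` and its length in the
variable `x`. -/
def Store.HoldsList (s : Store) (x a : ℕ) (w : List ℤ) : Prop :=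
  s.var x = (w.length : ℤ) ∧ ∀ j : ℕ, j < w.length → s.arr a (j : ℤ) = w.getD j 0

theorem Store.HoldsList.of_eq {s s' : Store} {x a : ℕ} {w : List ℤ} (h : s.HoldsList x a w)
    (hvar : s'.var x = s.var x) (harr : s'.arr a = s.arr a) : s'.HoldsList x a w := by
  rwa [HoldsList, hvar, harr]

/-- Append a letter to the word in the array `a` with length `x`. -/
def append (x a : ℕ) (e : Exp) : Prog :=
  .write a (.var x) e ;; x ::= .var x + 1

/-- The program `c`, started in `s`, appends the word `u` to the word in the array `a` with length
`x`, as long as lengths up to `N` suffice. -/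
def Appends (N x a : ℕ) (c : Prog) (s : Store) (u : List ℤ) : Prop :=
  ∀ w, s.HoldsList x a w → (w ++ u).length ≤ N → Runs N c s fun s' => s'.HoldsList x a (w ++ u)

namespace Appends

variable {N x a : ℕ} {s : Store} {c c₁ c₂ : Prog} {u u₁ u₂ : List ℤ}

theorem append {e : Exp} (he : |e.eval s| ≤ 2 ^ N) :
    Appends N x a (append x a e) s [e.eval s] := by
  intro w hw hN
  rw [List.length_append, List.length_singleton] at hN
  refine .seq (.write he (.assign ?_ ⟨?_, fun j hj => ?_⟩))
  · simpa [hw.1] using abs_natCast_le_two_pow hN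
  · simp [hw.1]
  · simp only [Store.arr_setVar, Store.arr_setArr, if_pos, Exp.eval_var, hw.1,
      Function.update_apply, Nat.cast_inj]
    split_ifs with h
    · simp [h]
    · have hjw : j < w.length := by
        rw [List.length_append, List.length_singleton] at hj
        omega
      rw [hw.2 j hjw, List.getD_append _ _ _ _ hjw]

theorem skip : Appends N x a .skip s [] := fun w hw _ => .skip (by rwa [List.append_nil])

theorem ite_pos {e : Exp} (he : 0 < e.eval s) (h : Appends N x a c₁ s u) :
    Appends N x a (.ite e c₁ c₂) s u := fun w hw hN =>
  .ite (fun _ => h w hw hN) fun hneg => absurd he hneg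

theorem ite_neg {e : Exp} (he : ¬ 0 < e.eval s) (h : Appends N x a c₂ s u) :
    Appends N x a (.ite e c₁ c₂) s u := fun w hw hN =>
  .ite (fun hpos => absurd hpos he) fun _ => h w hw hN

theorem seq (h₁ : Appends N x a c₁ s u₁) (h₂ : ∀ s', c₁.Frame s s' → Appends N x a c₂ s' u₂) :
    Appends N x a (c₁ ;; c₂) s (u₁ ++ u₂) := by
  intro w hw hN
  rw [← List.append_assoc] at hN ⊢
  exact .seq ((h₁ w hw (by rw [List.length_append] at hN; omega)).mono fun s' hF hw' =>
    h₂ s' hF _ hw' hN)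

theorem forLoop {z y n : ℕ} {g : Fin n → List ℤ} (hn : s.var y = n) (hnN : n ≤ N)
    (step : ∀ i : Fin n, ∀ s', (SparseMat.forLoop z y c).Frame s s' → s'.var z = (i : ℕ) →
      Appends N x a c s' (g i))
    (hz : z ∉ c.modVars := by decide) (hy : y ∉ z :: c.modVars := by decide)
    (hx : x ≠ z := by decide) :
    Appends N x a (SparseMat.forLoop z y c) s ((List.finRange n).flatMap g) := by
  intro w hw hN
  refine Runs.forLoop hn hnN hz hy
    (fun i s' => s'.HoldsList x a (w ++ ((List.finRange n).take i).flatMap g))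
    (fun i s' v h => h.of_eq (by simp [hx]) rfl) (by simpa using hw) (fun i s' hF hi hI => ?_)
    fun s' _ h => by rwa [List.take_of_length_le (by simp)] at h
  have take_succ : (List.finRange n).take (i + 1) = (List.finRange n).take i ++ [i] := by
    rw [List.take_succ_eq_append_getElem (by simp)]
    simp
  have flatMap_take_succ : ((List.finRange n).take (i + 1)).flatMap g =
      ((List.finRange n).take i).flatMap g ++ g i := by
    rw [take_succ, List.flatMap_append, List.flatMap_singleton]
  rw [flatMap_take_succ, ← List.append_assoc]
  refine step i s' hF hi _ hI (le_trans ?_ hN)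
  rw [List.append_assoc, ← flatMap_take_succ]
  exact (((List.take_sublist _ _).flatMap g).append_left w).length_le

end Appends

/-! ### Running a program on an input -/

theorem abs_le_two_pow_bitLen (z : ℤ) : |z| ≤ 2 ^ bitLen z := by
  rw [Int.abs_eq_natAbs]
  exact_mod_cast (Nat.lt_size_self z.natAbs).le.trans
    (Nat.pow_le_pow_right two_pos (Nat.le_succ z.natAbs.size))

theorem length_le_wordSize (w : List ℤ) : w.length ≤ wordSize w := by
  simpa [wordSize] using List.length_le_sum_of_one_le (w.map bitLen) (by simp [bitLen])

theorem abs_getD_le_two_pow_wordSize (w : List ℤ) (i : ℕ) : |w.getD i 0| ≤ 2 ^ wordSize w := by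
  rcases lt_or_ge i w.length with hi | hi
  · rw [List.getD_eq_getElem _ _ hi]
    exact (abs_le_two_pow_bitLen _).trans (pow_le_pow_right₀ one_le_two
      (List.le_sum_of_mem (List.mem_map_of_mem (List.getElem_mem hi))))
  · rw [List.getD_eq_default _ _ hi]
    simp

theorem Store.bounded_init (ws : List (List ℤ)) :
    (Store.init ws).Bounded (ws.map wordSize).sum := by
  have wordSize_getD_le (i : ℕ) : wordSize (ws.getD i []) ≤ (ws.map wordSize).sum := by
    rcases lt_or_ge i ws.length with hi | hi
    · rw [List.getD_eq_getElem _ _ hi]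
      exact List.le_sum_of_mem (List.mem_map_of_mem (List.getElem_mem hi))
    · rw [List.getD_eq_default _ _ hi]
      simp [wordSize]
  refine ⟨fun x => ?_, fun a i => ?_⟩
  · exact abs_natCast_le_two_pow ((length_le_wordSize _).trans (wordSize_getD_le x))
  · simp only [Store.init]
    split_ifs
    · exact (abs_getD_le_two_pow_wordSize _ _).trans
        (pow_le_pow_right₀ one_le_two (wordSize_getD_le a))
    · simp

theorem Store.Bounded.mono {N N' : ℕ} {s : Store} (h : s.Bounded N) (hN : N ≤ N') :
    s.Bounded N' where
  abs_var_le x := (h.abs_var_le x).trans (pow_le_pow_right₀ one_le_two hN)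
  abs_arr_le a i := (h.abs_arr_le a i).trans (pow_le_pow_right₀ one_le_two hN)

theorem exists_polyTime_of_runs {α β : Type} {encIn : α → List (List ℤ)} {encOut : β → List ℤ}
    {P : α → β → Prop} (c : Prog) (p : Polynomial ℕ) (hp : ∀ n, n ≤ p.eval n)
    (hc : ∀ a, Runs (p.eval ((encIn a).map wordSize).sum) c (Store.init (encIn a))
      fun s => ∃ b, P a b ∧ s.Outputs (encOut b)) :
    ∃ f, PolyTime encIn encOut f ∧ ∀ a, P a (f a) := by
  choose s t exec ht _ f hP output using fun a => hc a ((Store.bounded_init _).mono (hp _))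
  obtain ⟨time, htime⟩ := c.exists_polynomial_eval_eq_time
  refine ⟨f, ⟨c, time.comp p, fun a => ⟨s a, t a, exec a, ?_, output a⟩⟩, hP⟩
  rw [Polynomial.eval_comp, htime]
  exact ht a

/-! ### Input and output of matrices -/

/-- All values that occur on inputs of bit size `S` have absolute value at most
`2 ^ bitBound S`. -/
def bitBound (S : ℕ) : ℕ := (S + 2) ^ 3

theorem le_bitBound_of_le {S n : ℕ} (h : n ≤ 2 * S + 2 + 2 * S ^ 2) : n ≤ bitBound S := by
  rw [bitBound]
  nlinarith [Nat.zero_le (S ^ 3)]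

theorem mul_le_bitBound {S m n : ℕ} (hm : m ≤ S) (hn : n ≤ S) : m * n ≤ bitBound S :=
  le_bitBound_of_le (by nlinarith [Nat.mul_le_mul hm hn])

/-- The current matrix of the store is `M`, whose dimensions are at most `S`. -/
structure Store.HasMatrix {p q : ℕ} (S : ℕ) (s : Store) (M : Matrix (Fin p) (Fin q) ℤ) : Prop where
  rows_le : p ≤ S
  cols_le : q ≤ S
  var_rows : s.var Reg.rows = p
  var_cols : s.var Reg.cols = q
  holds : HoldsMatrix (s.arr Arr.mat) M

theorem Store.HasMatrix.frame {p q S : ℕ} {M : Matrix (Fin p) (Fin q) ℤ} {c : Prog}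
    {s s' : Store} (hM : s.HasMatrix S M) (hF : c.Frame s s')
    (hrows : Reg.rows ∉ c.modVars := by decide) (hcols : Reg.cols ∉ c.modVars := by decide)
    (hmat : Arr.mat ∉ c.modArrs := by decide) : s'.HasMatrix S M where
  rows_le := hM.rows_le
  cols_le := hM.cols_le
  var_rows := (hF.var_eq _ hrows).trans hM.var_rows
  var_cols := (hF.var_eq _ hcols).trans hM.var_cols
  holds := by rw [hF.arr_eq _ hmat]; exact hM.holds

theorem getD_flatMap {ι : Type*} {k : ℕ} (f : ι → List ℤ) (hf : ∀ i, (f i).length = k)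
    (l : List ι) {i r : ℕ} (hi : i < l.length) (hr : r < k) :
    (l.flatMap f).getD (i * k + r) 0 = (f l[i]).getD r 0 := by
  induction l generalizing i with
  | nil => simp at hi
  | cons a l ih =>
    rw [List.flatMap_cons]
    cases i with
    | zero =>
      rw [List.getD_append _ _ _ _ (by rw [hf]; omega)]
      simp
    | succ i =>
      have index_eq : (i + 1) * k + r = k + (i * k + r) := by ring
      rw [List.getD_append_right _ _ _ _ (by rw [hf, index_eq]; omega), hf, index_eq,
        Nat.add_sub_cancel_left, ih (by simpa using hi)]
      simp

namespace RatMatrix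

variable (A : RatMatrix)

theorem length_code : A.code.length = A.rows + A.cols + 2 + 2 * (A.rows * A.cols) := by
  simp only [code, List.length_append, List.length_cons, List.length_replicate,
    List.length_flatMap, List.length_nil, List.map_const', List.sum_replicate, List.length_finRange,
    smul_eq_mul]
  ring

theorem getD_code_of_lt_rows {i : ℕ} (hi : i < A.rows) : A.code.getD i 0 = 1 := by
  rw [code, List.getD_append _ _ _ _ (by simpa using hi), List.getD_replicate _ hi]

theorem getD_code_rows : A.code.getD A.rows 0 = 0 := by
  rw [code, List.getD_append_right _ _ _ _ (by simp)]
  simp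

theorem getD_code_rows_add (i : ℕ) : A.code.getD (A.rows + 1 + i) 0 =
    (List.replicate A.cols 1 ++ 0 ::
      (List.finRange A.rows).flatMap fun i => (List.finRange A.cols).flatMap fun j =>
        [(A.entries i j).num, ((A.entries i j).den : ℤ)]).getD i 0 := by
  rw [code, List.getD_append_right _ _ _ _ (by simp; omega), List.length_replicate,
    show A.rows + 1 + i - A.rows = i + 1 by omega, List.getD_cons_succ]

theorem getD_code_of_lt_cols {j : ℕ} (hj : j < A.cols) :
    A.code.getD (A.rows + 1 + j) 0 = 1 := by
  rw [getD_code_rows_add, List.getD_append _ _ _ _ (by simpa using hj), List.getD_replicate _ hj]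

theorem getD_code_cols : A.code.getD (A.rows + 1 + A.cols) 0 = 0 := by
  rw [getD_code_rows_add, List.getD_append_right _ _ _ _ (by simp)]
  simp

theorem getD_code_entry (i : Fin A.rows) (j : Fin A.cols) {r : ℕ} (hr : r < 2) :
    A.code.getD (A.rows + A.cols + 2 + 2 * (i * A.cols + j) + r) 0 =
      [(A.entries i j).num, ((A.entries i j).den : ℤ)].getD r 0 := by
  have index_eq : A.rows + A.cols + 2 + 2 * (i * A.cols + j) + r =
      A.rows + 1 + (A.cols + (i * (A.cols * 2) + (j * 2 + r) + 1)) := by ring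
  rw [index_eq, getD_code_rows_add, List.getD_append_right _ _ _ _ (by simp),
    List.length_replicate, Nat.add_sub_cancel_left, List.getD_cons_succ,
    getD_flatMap (k := A.cols * 2) _ (by simp [List.length_flatMap]) _ (by simp)
      (by have := j.2; omega),
    getD_flatMap (k := 2) _ (by simp) _ (by simp) hr]
  simp

theorem getD_code_num (i : Fin A.rows) (j : Fin A.cols) :
    A.code.getD (A.rows + A.cols + 2 + 2 * (i * A.cols + j)) 0 = (A.entries i j).num :=
  A.getD_code_entry i j two_pos

/-- The denominator of the `z`-th entry, rows first, as it stands in the code. -/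
def codeDen (z : ℕ) : ℤ := A.code.getD (A.rows + A.cols + 2 + 2 * z + 1) 0

theorem codeDen_eq (i : Fin A.rows) (j : Fin A.cols) :
    A.codeDen (i * A.cols + j) = (A.entries i j).den :=
  A.getD_code_entry i j one_lt_two

/-- The product of all denominators, a common denominator of the entries. -/
def commonDen : ℤ := ∏ z ∈ Finset.range (A.rows * A.cols), A.codeDen z

/-- The integer matrix obtained by clearing denominators. -/
def cleared : Matrix (Fin A.rows) (Fin A.cols) ℤ :=
  .of fun i j => (A.entries i j).num * (A.commonDen / (A.entries i j).den)

theorem commonDen_ne_zero : A.commonDen ≠ 0 := by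
  refine Finset.prod_ne_zero_iff.2 fun z hz => ?_
  let z' : Fin (A.rows * A.cols) := ⟨z, Finset.mem_range.1 hz⟩
  have hden := A.codeDen_eq z'.divNat z'.modNat
  rw [Fin.coe_divNat, Fin.coe_modNat, Nat.div_add_mod'] at hden
  rw [hden]
  exact_mod_cast Rat.den_ne_zero _

theorem commonDen_smul_entries :
    (A.commonDen : ℚ) • A.entries = A.cleared.map (Int.cast : ℤ → ℚ) := by
  ext i j
  have den_dvd : ((A.entries i j).den : ℤ) ∣ A.commonDen := by
    rw [← codeDen_eq]
    refine Finset.dvd_prod_of_mem _ (Finset.mem_range.2 ?_)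
    nlinarith [i.2, j.2]
  have den_ne_zero : ((A.entries i j).den : ℚ) ≠ 0 := by exact_mod_cast Rat.den_ne_zero _
  rw [Matrix.smul_apply, Matrix.map_apply, cleared, Matrix.of_apply, Int.cast_mul,
    Int.cast_div den_dvd (by exact_mod_cast den_ne_zero), Int.cast_natCast, smul_eq_mul,
    ← mul_div_assoc, mul_div_right_comm, Rat.num_div_den, mul_comm]

theorem dims_le_wordSize :
    A.rows + A.cols + 2 + 2 * (A.rows * A.cols) ≤ wordSize A.code :=
  A.length_code ▸ length_le_wordSize _

theorem abs_prod_codeDen_le {z : ℕ} (hz : z ≤ A.rows * A.cols) :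
    |∏ y ∈ Finset.range z, A.codeDen y| ≤ 2 ^ (wordSize A.code ^ 2) :=
  calc |∏ y ∈ Finset.range z, A.codeDen y|
    _ ≤ ∏ y ∈ Finset.range z, 2 ^ wordSize A.code := by
      rw [Finset.abs_prod]
      exact Finset.prod_le_prod (fun _ _ => abs_nonneg _)
        fun _ _ => abs_getD_le_two_pow_wordSize _ _
    _ = 2 ^ (wordSize A.code * z) := by rw [Finset.prod_const, Finset.card_range, ← pow_mul]
    _ ≤ _ := by
      have := A.dims_le_wordSize
      rw [sq]
      exact pow_le_pow_right₀ one_le_two (Nat.mul_le_mul_left _ (by omega))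

theorem abs_cleared_le (i : Fin A.rows) (j : Fin A.cols) :
    |A.cleared i j| ≤ 2 ^ (wordSize A.code + wordSize A.code ^ 2) := by
  have abs_num_le := abs_getD_le_two_pow_wordSize A.code
    (A.rows + A.cols + 2 + 2 * (i * A.cols + j))
  rw [getD_code_num] at abs_num_le
  rw [cleared, Matrix.of_apply, abs_mul, pow_add]
  exact mul_le_mul abs_num_le ((abs_ediv_le_abs _ _).trans (A.abs_prod_codeDen_le le_rfl))
    (abs_nonneg _) (by positivity)

end RatMatrix

/-- Let `x` be the first natural number at which `e` is not positive. -/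
def search (x : ℕ) (e : Exp) : Prog :=
  x ::= 0 ;; .loop e (x ::= .var x + 1)

theorem Runs.search {N : ℕ} {s : Store} {x : ℕ} {e : Exp} {n : ℕ} (hn : n ≤ N)
    (pos : ∀ i < n, 0 < e.eval (s.setVar x i)) (not_pos : ¬ 0 < e.eval (s.setVar x n)) :
    Runs N (search x e) s (· = s.setVar x n) := by
  have setVar_setVar (v w : ℤ) : (s.setVar x v).setVar x w = s.setVar x w := by
    simp [Store.setVar]
  refine .seq (.assign (by simp) (.loop hn (fun i s' => s' = s.setVar x i) (by simp) ?_ ?_))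
  · rintro i hi _ - rfl
    refine ⟨pos i hi, .assign ?_ ?_⟩
    · simpa using abs_natCast_le_two_pow (Nat.succ_le_of_lt (hi.trans_le hn))
    · simp [setVar_setVar]
  · rintro _ - rfl
    exact not_pos

/-- Read the dimensions of the input matrix. -/
def loadDims : Prog :=
  search Reg.rows (.read Arr.io (.var Reg.rows)) ;;
  search Reg.cols (.read Arr.io (.var Reg.rows + 1 + .var Reg.cols))

/-- Multiply the denominators of the input matrix. -/
def loadDenom : Prog :=
  Reg.offset ::= .var Reg.rows + .var Reg.cols + 2 ;; Reg.size ::= .var Reg.rows * .var Reg.cols ;;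
  Reg.denom ::= 1 ;;
  forLoop Reg.z Reg.size (Reg.denom ::= .var Reg.denom *
    .read Arr.io (.var Reg.offset + 2 * .var Reg.z + 1))

/-- The entry with index `(i, j)` of the input matrix, multiplied by the common denominator. -/
def loadEntry : Prog :=
  Reg.x ::= .var Reg.offset + 2 * (.var Reg.i * .var Reg.cols + .var Reg.j) ;;
  Reg.acc ::= .read Arr.io (.var Reg.x) * (.var Reg.denom / .read Arr.io (.var Reg.x + 1))

/-- Clear the denominators of the input matrix and make it the current matrix. -/
def loadProg : Prog :=
  loadDims ;; loadDenom ;; tabulate Arr.mat (.var Reg.rows) (.var Reg.cols) loadEntry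

section Load

variable {A : RatMatrix} {s : Store}

theorem runs_loadDims (hA : s.HoldsList Reg.outLen Arr.io A.code) :
    Runs (bitBound (wordSize A.code)) loadDims s fun s' =>
      s'.var Reg.rows = A.rows ∧ s'.var Reg.cols = A.cols := by
  have dims_le := A.dims_le_wordSize
  have length_code := A.length_code
  have arr_row (i : ℕ) (hi : i < A.rows) : s.arr Arr.io i = 1 := by
    rw [hA.2 i (by omega), A.getD_code_of_lt_rows hi]
  have arr_rows : s.arr Arr.io A.rows = 0 := by rw [hA.2 _ (by omega), A.getD_code_rows]
  have arr_col (j : ℕ) (hj : j < A.cols) : s.arr Arr.io (A.rows + 1 + j) = 1 := by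
    have := hA.2 (A.rows + 1 + j) (by omega)
    rw [A.getD_code_of_lt_cols hj] at this
    exact_mod_cast this
  have arr_cols : s.arr Arr.io (A.rows + 1 + A.cols) = 0 := by
    rw [← A.getD_code_cols, ← hA.2 _ (by omega)]
    norm_cast
  refine .seq ((Runs.search (le_bitBound_of_le (n := A.rows) (by omega)) ?_ ?_).mono ?_)
  · intro i hi
    simp [arr_row i hi]
  · simp [arr_rows]
  rintro _ - rfl
  refine (Runs.search (le_bitBound_of_le (n := A.cols) (by omega)) ?_ ?_).mono ?_
  · intro j hj
    simp [arr_col j hj]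
  · simp [arr_cols]
  · rintro _ - rfl
    simp

theorem runs_loadDenom (hA : s.HoldsList Reg.outLen Arr.io A.code)
    (hrows : s.var Reg.rows = A.rows) (hcols : s.var Reg.cols = A.cols) :
    Runs (bitBound (wordSize A.code)) loadDenom s fun s' =>
      s'.var Reg.offset = (A.rows + A.cols + 2 : ℕ) ∧ s'.var Reg.denom = A.commonDen := by
  have dims_le := A.dims_le_wordSize
  have length_code := A.length_code
  have size_le : A.rows * A.cols ≤ bitBound (wordSize A.code) := le_bitBound_of_le (by omega)
  have offset_le : A.rows + A.cols + 2 ≤ bitBound (wordSize A.code) :=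
    le_bitBound_of_le (by omega)
  refine .seq (.assign ?_ (.seq (.assign ?_ (.seq (.assign ?_ ?_)))))
  · simpa [hrows, hcols] using abs_natCast_le_two_pow offset_le
  · simpa [hrows, hcols] using abs_natCast_le_two_pow size_le
  · simpa using one_le_pow₀ one_le_two
  refine Runs.forLoop (n := A.rows * A.cols) (by simp [hrows, hcols]) size_le (by decide)
    (by decide) (fun z s' => s'.var Reg.denom = ∏ y ∈ Finset.range z, A.codeDen y)
    (fun i s' v h => ?_) (by simp) (fun z s' hF hz hI => ?_) fun s' hF hI => ⟨?_, hI⟩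
  · simpa using h
  · have offset_eq : s'.var Reg.offset = A.rows + A.cols + 2 := by
      rw [hF.var_eq _ (by decide)]
      simp [hrows, hcols]
    have arr_den : s'.arr Arr.io (A.rows + A.cols + 2 + 2 * (z : ℕ) + 1) = A.codeDen z := by
      rw [hF.arr_eq _ (by decide), RatMatrix.codeDen, ← hA.2 _ (by omega)]
      norm_cast
    have eval_eq : (Exp.var Reg.denom * .read Arr.io (.var Reg.offset + 2 * .var Reg.z + 1)).eval
        s' = ∏ y ∈ Finset.range (z + 1), A.codeDen y := by
      rw [Finset.prod_range_succ, ← arr_den, ← hI]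
      simp [offset_eq, hz]
    refine .assign ?_ ?_
    · rw [eval_eq]
      refine (A.abs_prod_codeDen_le z.2).trans (pow_le_pow_right₀ one_le_two ?_)
      exact le_bitBound_of_le (by omega)
    · rw [Store.var_setVar, if_pos rfl, eval_eq]
  · rw [hF.var_eq _ (by decide)]
    simp [hrows, hcols]

theorem runs_loadEntry (hA : s.HoldsList Reg.outLen Arr.io A.code)
    (hcols : s.var Reg.cols = A.cols) (hoffset : s.var Reg.offset = (A.rows + A.cols + 2 : ℕ))
    (hdenom : s.var Reg.denom = A.commonDen) {i : Fin A.rows} {j : Fin A.cols}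
    (hi : s.var Reg.i = (i : ℕ)) (hj : s.var Reg.j = (j : ℕ)) :
    Runs (bitBound (wordSize A.code)) loadEntry s fun s' => s'.var Reg.acc = A.cleared i j := by
  have dims_le := A.dims_le_wordSize
  have length_code := A.length_code
  have index_lt : A.rows + A.cols + 2 + 2 * (i * A.cols + j) + 1 < A.code.length := by
    nlinarith [i.2, j.2]
  have arr_num : s.arr Arr.io (A.rows + A.cols + 2 + 2 * ((i : ℕ) * A.cols + (j : ℕ))) =
      (A.entries i j).num := by
    rw [← A.getD_code_num, ← hA.2 _ (by omega)]
    norm_cast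
  have arr_den : s.arr Arr.io (A.rows + A.cols + 2 + 2 * ((i : ℕ) * A.cols + (j : ℕ)) + 1) =
      (A.entries i j).den := by
    rw [← A.codeDen_eq, RatMatrix.codeDen, ← hA.2 _ index_lt]
    norm_cast
  have eval_x : (Exp.var Reg.offset + 2 * (.var Reg.i * .var Reg.cols + .var Reg.j)).eval s =
      A.rows + A.cols + 2 + 2 * ((i : ℕ) * A.cols + (j : ℕ)) := by
    simp [hcols, hoffset, hi, hj]
  refine .seq (.assign ?_ (.assign ?_ ?_)) <;> rw [eval_x]
  · exact_mod_cast abs_natCast_le_two_pow (le_bitBound_of_le (by omega))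
  · simpa [arr_num, arr_den, hdenom, RatMatrix.cleared] using
      (A.abs_cleared_le i j).trans (pow_le_pow_right₀ one_le_two (le_bitBound_of_le (by omega)))
  · simp [arr_num, arr_den, hdenom, RatMatrix.cleared]

theorem runs_loadProg (hA : s.HoldsList Reg.outLen Arr.io A.code) :
    Runs (bitBound (wordSize A.code)) loadProg s (·.HasMatrix (wordSize A.code) A.cleared) := by
  have dims_le := A.dims_le_wordSize
  refine .seq ((runs_loadDims hA).mono fun s₁ hF₁ ⟨hrows₁, hcols₁⟩ => ?_)
  have hA₁ := hA.of_eq (hF₁.var_eq _ (by decide)) (hF₁.arr_eq _ (by decide))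
  refine .seq ((runs_loadDenom hA₁ hrows₁ hcols₁).mono fun s₂ hF₂ ⟨hoffset, hdenom⟩ => ?_)
  have hA₂ := hA₁.of_eq (hF₂.var_eq _ (by decide)) (hF₂.arr_eq _ (by decide))
  have hrows₂ : s₂.var Reg.rows = A.rows := (hF₂.var_eq _ (by decide)).trans hrows₁
  have hcols₂ : s₂.var Reg.cols = A.cols := (hF₂.var_eq _ (by decide)).trans hcols₁
  refine (Runs.tabulate (M := A.cleared) (le_bitBound_of_le (by omega))
    (le_bitBound_of_le (by omega)) (by simp [hcols₂]) (by simp [hrows₂]) ?_).mono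
    fun s₃ hF₃ hM => ⟨by omega, by omega, ?_, ?_, hM⟩
  · intro i j s' hF hi hj
    exact runs_loadEntry (hA₂.of_eq (hF.var_eq _ (by decide)) (hF.arr_eq _ (by decide)))
      ((hF.var_eq _ (by decide)).trans hcols₂) ((hF.var_eq _ (by decide)).trans hoffset)
      ((hF.var_eq _ (by decide)).trans hdenom) hi hj
  · exact (hF₃.var_eq _ (by decide)).trans hrows₂
  · exact (hF₃.var_eq _ (by decide)).trans hcols₂

end Load

/-- Transpose the current matrix. -/
def transposeProg : Prog :=
  tabulate Arr.mat (.var Reg.cols) (.var Reg.rows)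
    (Reg.acc ::= .read Arr.mat (.var Reg.j * .var Reg.cols + .var Reg.i)) ;;
  Reg.x ::= .var Reg.rows ;; Reg.rows ::= .var Reg.cols ;; Reg.cols ::= .var Reg.x

/-- Append the entries of the current matrix to the output. -/
def emitEntries : Prog :=
  forLoop Reg.i Reg.rows (forLoop Reg.j Reg.cols
    (append Reg.outLen Arr.io (.read Arr.mat (.var Reg.i * .var Reg.cols + .var Reg.j)) ;;
      append Reg.outLen Arr.io 1))

/-- Output the current matrix. -/
def emitProg : Prog :=
  Reg.outLen ::= 0 ;;
  forLoop Reg.i Reg.rows (append Reg.outLen Arr.io 1) ;; append Reg.outLen Arr.io 0 ;;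
  forLoop Reg.j Reg.cols (append Reg.outLen Arr.io 1) ;; append Reg.outLen Arr.io 0 ;;
  emitEntries

section Emit

variable {p q S : ℕ} {M : Matrix (Fin p) (Fin q) ℤ} {s : Store}

theorem runs_transposeProg (hM : s.HasMatrix S M) :
    Runs (bitBound S) transposeProg s (·.HasMatrix S Mᵀ) := by
  have ⟨hp, hq, hrows, hcols, _⟩ := hM
  have dim_le {n : ℕ} (hn : n ≤ S) : |(n : ℤ)| ≤ 2 ^ bitBound S :=
    abs_natCast_le_two_pow (le_bitBound_of_le (by omega))
  refine .seq ((Runs.tabulate (M := Mᵀ) (le_bitBound_of_le (by omega)) (mul_le_bitBound hq hp)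
    (by simp [hrows]) (by simp [hcols]) ?_).mono fun s' hF holds' => ?_)
  · intro i j s' hF hi hj
    have entry_eq :
        (Exp.read Arr.mat (.var Reg.j * .var Reg.cols + .var Reg.i)).eval s' = M j i := by
      rw [← (hM.frame hF).holds]
      simp [hi, hj, (hM.frame hF).var_cols]
    refine .of_bounded fun hs' => .assign (hs'.abs_arr_le _ _) ?_
    rw [Store.var_setVar, if_pos rfl, entry_eq, Matrix.transpose_apply]
  · have hrows' : s'.var Reg.rows = p := (hF.var_eq _ (by decide)).trans hrows
    have hcols' : s'.var Reg.cols = q := (hF.var_eq _ (by decide)).trans hcols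
    refine .seq (.assign ?_ (.seq (.assign ?_ (.assign ?_ ⟨hq, hp, ?_, ?_, holds'⟩))))
    · simpa [hrows'] using dim_le hp
    · simpa [hcols'] using dim_le hq
    · simpa [hrows'] using dim_le hp
    · simp [hcols']
    · simp [hrows']

theorem appends_emitEntries (hM : s.HasMatrix S M) :
    Appends (bitBound S) Reg.outLen Arr.io emitEntries s
      ((List.finRange p).flatMap fun i => (List.finRange q).flatMap fun j => [M i j, 1]) := by
  refine .forLoop hM.var_rows (le_bitBound_of_le (by have := hM.rows_le; omega))
    fun i s₁ hF₁ hi => .forLoop (hM.frame hF₁).var_cols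
      (le_bitBound_of_le (by have := hM.cols_le; omega)) fun j s₂ hF₂ hj => ?_
  have hM₂ := (hM.frame hF₁).frame hF₂
  have entry_eq :
      (Exp.read Arr.mat (.var Reg.i * .var Reg.cols + .var Reg.j)).eval s₂ = M i j := by
    rw [← hM₂.holds]
    simp [hj, hM₂.var_cols, hF₂.var_eq Reg.i (by decide), hi]
  rw [← entry_eq]
  intro w hw hN
  refine Runs.of_bounded fun hs₂ => Appends.seq (u₁ := [_]) (.append (hs₂.abs_arr_le _ _))
    (fun _ _ => .append (e := 1) ?_) w hw hN
  simpa using one_le_pow₀ one_le_two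

theorem appends_emitProg (hM : s.HasMatrix S M) :
    Appends (bitBound S) Reg.outLen Arr.io
      (forLoop Reg.i Reg.rows (append Reg.outLen Arr.io 1) ;; append Reg.outLen Arr.io 0 ;;
        forLoop Reg.j Reg.cols (append Reg.outLen Arr.io 1) ;; append Reg.outLen Arr.io 0 ;;
        emitEntries) s (RatMatrix.code ⟨p, q, M.map (Int.cast : ℤ → ℚ)⟩) := by
  have hp : p ≤ bitBound S := le_bitBound_of_le (by have := hM.rows_le; omega)
  have hq : q ≤ bitBound S := le_bitBound_of_le (by have := hM.cols_le; omega)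
  have appends_zero (s : Store) :
      Appends (bitBound S) Reg.outLen Arr.io (append Reg.outLen Arr.io 0) s [0] :=
    .append (e := 0) (by simp)
  have appends_one (s : Store) :
      Appends (bitBound S) Reg.outLen Arr.io (append Reg.outLen Arr.io 1) s [1] :=
    .append (e := 1) (by simpa using one_le_pow₀ one_le_two)
  have code_eq : RatMatrix.code ⟨p, q, M.map (Int.cast : ℤ → ℚ)⟩ =
      (List.finRange p).flatMap (fun _ => [1]) ++ ([0] ++ ((List.finRange q).flatMap (fun _ => [1])
        ++ ([0] ++ (List.finRange p).flatMap fun i =>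
          (List.finRange q).flatMap fun j => [M i j, 1]))) := by
    simp [RatMatrix.code, ← List.map_eq_flatMap]
  rw [code_eq]
  refine .seq (.forLoop hM.var_rows hp fun _ s' _ _ => appends_one s') fun s₁ hF₁ => ?_
  refine .seq (appends_zero s₁) fun s₂ hF₂ => ?_
  have hM₂ := (hM.frame hF₁).frame hF₂
  refine .seq (.forLoop hM₂.var_cols hq fun _ s' _ _ => appends_one s') fun s₃ hF₃ => ?_
  exact .seq (appends_zero s₃) fun s₄ hF₄ => appends_emitEntries ((hM₂.frame hF₃).frame hF₄)

theorem runs_emitProg (hM : s.HasMatrix S M) :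
    Runs (bitBound S) emitProg s
      (·.Outputs (RatMatrix.code ⟨p, q, M.map (Int.cast : ℤ → ℚ)⟩)) := by
  have hp := hM.rows_le
  have hq := hM.cols_le
  have hM₀ : (s.setVar Reg.outLen 0).HasMatrix S M := hM.frame (Exec.assign Reg.outLen 0 s).frame
  refine .seq (.assign (by simp) (appends_emitProg hM₀ [] (by simp [Store.HoldsList]) ?_))
  rw [List.nil_append, RatMatrix.length_code]
  exact le_bitBound_of_le (by nlinarith)

end Emit

/-! ### The elimination program -/

/-- A bound on the absolute values of the entries after clearing denominators, for inputs of bit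
size `S`. -/
def entryBound (S : ℕ) : ℤ := 2 ^ (S + S ^ 2)

theorem one_le_entryBound (S : ℕ) : 1 ≤ entryBound S := one_le_pow₀ one_le_two

theorem mul_factorial_mul_entryBound_pow_le {q S : ℕ} (hq : q ≤ S) :
    (q + 1) * (entryBound S * (q.factorial * entryBound S ^ q)) ≤ 2 ^ bitBound S := by
  have factorial_le : q.factorial ≤ 2 ^ (q * q) :=
    calc q.factorial ≤ q ^ q := q.factorial_le_pow
      _ ≤ (2 ^ q) ^ q := Nat.pow_le_pow_left q.lt_two_pow_self.le q
      _ = 2 ^ (q * q) := (pow_mul 2 q q).symm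
  calc (q + 1) * (entryBound S * (q.factorial * entryBound S ^ q))
    _ ≤ 2 ^ q * (entryBound S * (2 ^ (q * q) * entryBound S ^ q)) := by
      have : 0 ≤ entryBound S := by rw [entryBound]; positivity
      gcongr
      · exact_mod_cast q.lt_two_pow_self
      · exact_mod_cast factorial_le
    _ = 2 ^ (q + ((S + S ^ 2) + (q * q + (S + S ^ 2) * q))) := by
      simp only [entryBound, pow_add, pow_mul]
    _ ≤ 2 ^ bitBound S := by
      refine pow_le_pow_right₀ one_le_two ?_
      calc q + ((S + S ^ 2) + (q * q + (S + S ^ 2) * q))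
        _ ≤ S + ((S + S ^ 2) + (S * S + (S + S ^ 2) * S)) := by gcongr
        _ ≤ (S + 2) ^ 3 := by nlinarith

/-- Leave `∑ x < y, e` in `acc`. -/
def sum (x y : ℕ) (e : Exp) : Prog :=
  Reg.acc ::= 0 ;; forLoop x y (Reg.acc ::= .var Reg.acc + e)

theorem Runs.sum {N x y n : ℕ} {e : Exp} {s : Store} {g : Fin n → ℤ} {C : ℤ} (hn : s.var y = n)
    (hnN : n ≤ N) (hg : ∀ i, |g i| ≤ C) (hC : n * C ≤ 2 ^ N)
    (he : ∀ i : Fin n, ∀ s', (SparseMat.sum x y e).Frame s s' → s'.var x = (i : ℕ) →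
      e.eval s' = g i)
    (hx : x ≠ Reg.acc := by decide) (hy : y ≠ x ∧ y ≠ Reg.acc := by decide) :
    Runs N (SparseMat.sum x y e) s fun s' => s'.var Reg.acc = ∑ i, g i := by
  refine .seq (.assign (by simp) ?_)
  refine Runs.forLoop (by simpa [hy.2] using hn) hnN (by simpa [Prog.modVars] using hx)
    (by simpa [Prog.modVars] using hy)
    (fun i s' => s'.var Reg.acc = ∑ k : Fin n with k.val < i, g k) (fun i s' v h => ?_) (by simp)
    (fun i s' hF hi hI => ?_) fun s' _ h => by simpa using h
  · simpa [hx.symm] using h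
  · have filter_eq : Finset.univ.filter (fun k : Fin n => k.val < i.val + 1) =
        insert i (Finset.univ.filter fun k => k.val < i.val) := by
      ext k
      simp only [Finset.mem_filter_univ, Finset.mem_insert, Fin.ext_iff]
      omega
    have frame : (SparseMat.sum x y e).Frame s s' :=
      ((Prog.Frame.refl _ s).setVar 0 (by simp [SparseMat.sum, Prog.modVars])).trans hF.seq_right
    have eval_eq : (Exp.var Reg.acc + e).eval s' = ∑ k : Fin n with k.val < i.val + 1, g k := by
      rw [filter_eq, Finset.sum_insert (by simp), Exp.eval_add, Exp.eval_var, hI, he i s' frame hi,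
        add_comm]
    refine .assign ?_ (by rw [Store.var_setVar, if_pos rfl, eval_eq])
    rw [eval_eq]
    calc |∑ k : Fin n with k.val < i.val + 1, g k|
      _ ≤ ∑ k : Fin n with k.val < i.val + 1, |g k| := Finset.abs_sum_le_sum_abs _ _
      _ ≤ ∑ k, |g k| :=
        Finset.sum_le_sum_of_subset_of_nonneg (Finset.filter_subset _ _) fun _ _ _ => abs_nonneg _
      _ ≤ n * C := by simpa using Finset.sum_le_card_nsmul Finset.univ _ C fun k _ => hg k
      _ ≤ 2 ^ N := hC

/-- The entry `(i, j)` of the identity matrix. -/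
def oneEntryProg : Prog :=
  .ite (1 - (.var Reg.i - .var Reg.j) * (.var Reg.i - .var Reg.j))
    (Reg.acc ::= 1) (Reg.acc ::= 0)

/-- Start the elimination with the identity matrix. -/
def initProg : Prog :=
  Reg.det ::= 1 ;;
  tabulate Arr.adj (.var Reg.cols) (.var Reg.cols) oneEntryProg ;;
  tabulate Arr.flag 1 (.var Reg.cols) (Reg.acc ::= 1)

/-- Multiply the row `r` of the current matrix by the adjugate. -/
def productProg : Prog :=
  tabulate Arr.prod 1 (.var Reg.cols) (sum Reg.x Reg.cols
    (.read Arr.mat (.var Reg.r * .var Reg.cols + .var Reg.x) *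
      .read Arr.adj (.var Reg.x * .var Reg.cols + .var Reg.j)))

/-- Let `pivot - 1` be a free index at which the product does not vanish; `pivot` is `0` if there
is none. -/
def pivotProg : Prog :=
  Reg.pivot ::= 0 ;;
  forLoop Reg.x Reg.cols
    (.ite (.read Arr.flag (.var Reg.x) *
        (.read Arr.prod (.var Reg.x) * .read Arr.prod (.var Reg.x)))
      (Reg.pivot ::= .var Reg.x + 1) .skip)

/-- The entry `(i, j)` of the adjugate after the row `pivot` of the matrix has been replaced, by
Cramer's rule `det_mul_adjugate_updateRow_apply`. -/
def replaceEntryProg : Prog :=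
  .ite ((.var Reg.j - .var Reg.pivot) * (.var Reg.j - .var Reg.pivot))
    (Reg.acc ::= (.read Arr.prod (.var Reg.pivot) *
        .read Arr.adj (.var Reg.i * .var Reg.cols + .var Reg.j) -
      .read Arr.prod (.var Reg.j) *
        .read Arr.adj (.var Reg.i * .var Reg.cols + .var Reg.pivot)) / .var Reg.det)
    (Reg.acc ::= .read Arr.adj (.var Reg.i * .var Reg.cols + .var Reg.j))

/-- Replace the row `pivot` of the matrix whose adjugate is stored by the row `r` of the current
matrix. -/
def replaceProg : Prog :=
  tabulate Arr.adj (.var Reg.cols) (.var Reg.cols) replaceEntryProg ;;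
  Reg.det ::= .read Arr.prod (.var Reg.pivot) ;;
  .write Arr.flag (.var Reg.pivot) 0

/-- Eliminate with the equation in the row `r` of the current matrix. -/
def stepProg : Prog :=
  productProg ;; pivotProg ;;
  .ite (.var Reg.pivot) (Reg.pivot ::= .var Reg.pivot - 1 ;; replaceProg) .skip

/-- Eliminate with all rows of the current matrix. -/
def eliminateProg : Prog :=
  initProg ;; forLoop Reg.r Reg.rows stepProg

/-- List the free indices. -/
def freeProg : Prog :=
  Reg.freeCount ::= 0 ;;
  forLoop Reg.x Reg.cols
    (.ite (.read Arr.flag (.var Reg.x)) (append Reg.freeCount Arr.free (.var Reg.x)) .skip)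

/-- Make the columns of the adjugate with free index the current matrix. -/
def selectProg : Prog :=
  tabulate Arr.mat (.var Reg.cols) (.var Reg.freeCount)
    (Reg.acc ::= .read Arr.adj (.var Reg.i * .var Reg.cols + .read Arr.free (.var Reg.j))) ;;
  Reg.rows ::= .var Reg.cols ;; Reg.cols ::= .var Reg.freeCount

/-- Replace the current matrix by a full null matrix for it. -/
def kernelProg : Prog :=
  eliminateProg ;; freeProg ;; selectProg

/-- The store is in the elimination state `(M, F)`, after the equations in `E`. The array `flag` is
the indicator function of the set `F` of free indices. -/
structure Store.HasPivoted {q : ℕ} (S : ℕ) (s : Store) (E : Set (Fin q → ℤ))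
    (M : Matrix (Fin q) (Fin q) ℤ) (F : Finset (Fin q)) : Prop where
  isPivoted : IsPivoted E M F
  abs_le : ∀ i j, |M i j| ≤ entryBound S
  var_det : s.var Reg.det = M.det
  holds : HoldsMatrix (s.arr Arr.adj) M.adjugate
  arr_flag : ∀ k : Fin q, s.arr Arr.flag (k : ℕ) = if k ∈ F then 1 else 0

theorem Store.HasPivoted.frame {q S : ℕ} {E : Set (Fin q → ℤ)} {M : Matrix (Fin q) (Fin q) ℤ}
    {F : Finset (Fin q)} {c : Prog} {s s' : Store} (h : s.HasPivoted S E M F) (hF : c.Frame s s')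
    (hdet : Reg.det ∉ c.modVars := by decide) (hadj : Arr.adj ∉ c.modArrs := by decide)
    (hflag : Arr.flag ∉ c.modArrs := by decide) : s'.HasPivoted S E M F where
  isPivoted := h.isPivoted
  abs_le := h.abs_le
  var_det := (hF.var_eq _ hdet).trans h.var_det
  holds := by rw [hF.arr_eq _ hadj]; exact h.holds
  arr_flag := by rw [hF.arr_eq _ hflag]; exact h.arr_flag

section Kernel

variable {p q S : ℕ} {W : Matrix (Fin p) (Fin q) ℤ} {E : Set (Fin q → ℤ)}
  {M : Matrix (Fin q) (Fin q) ℤ} {F : Finset (Fin q)} {s : Store}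

theorem abs_adjugate_le_two_pow (hM : ∀ i j, |M i j| ≤ entryBound S) (hq : q ≤ S) (i j : Fin q) :
    |M.adjugate i j| ≤ 2 ^ bitBound S := by
  have hB := one_le_entryBound S
  have abs_adjugate_le := abs_adjugate_le hB hM i j
  rw [Fintype.card_fin] at abs_adjugate_le
  have bound_nonneg := (abs_nonneg _).trans abs_adjugate_le
  nlinarith [mul_factorial_mul_entryBound_pow_le hq, mul_nonneg (sub_nonneg.2 hB) bound_nonneg,
    mul_nonneg (Nat.cast_nonneg (α := ℤ) q) (mul_nonneg (sub_nonneg.2 hB) bound_nonneg),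
    mul_nonneg (Nat.cast_nonneg (α := ℤ) q) bound_nonneg]

theorem runs_oneEntryProg {N : ℕ} {i j : Fin q} (hi : s.var Reg.i = (i : ℕ))
    (hj : s.var Reg.j = (j : ℕ)) :
    Runs N oneEntryProg s fun s' => s'.var Reg.acc = (1 : Matrix (Fin q) (Fin q) ℤ) i j := by
  have eval_eq : (1 - (Exp.var Reg.i - .var Reg.j) * (.var Reg.i - .var Reg.j)).eval s =
      1 - ((i : ℕ) - (j : ℕ) : ℤ) * ((i : ℕ) - (j : ℕ) : ℤ) := by simp [hi, hj]
  refine .ite (fun hpos => ?_) fun hneg => ?_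
  · refine .assign (by simpa using one_le_pow₀ (one_le_two (α := ℤ))) ?_
    rw [eval_eq] at hpos
    obtain rfl : i = j := by
      ext
      have : ((i : ℕ) - (j : ℕ) : ℤ) = 0 := by nlinarith [sq_nonneg ((i : ℕ) - (j : ℕ) : ℤ)]
      omega
    simp
  · refine .assign (by simp) ?_
    have hij : i ≠ j := by
      rintro rfl
      simp [eval_eq] at hneg
    simp [Matrix.one_apply_ne hij]

theorem runs_initProg (hW : s.HasMatrix S W) :
    Runs (bitBound S) initProg s
      (·.HasPivoted S ∅ (1 : Matrix (Fin q) (Fin q) ℤ) Finset.univ) := by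
  have hq := hW.cols_le
  have one_le : (1 : ℤ) ≤ 2 ^ bitBound S := one_le_pow₀ one_le_two
  refine .seq (.assign (by simpa using one_le) ?_)
  set s₁ := s.setVar Reg.det ((1 : Exp).eval s)
  have hW₁ : s₁.HasMatrix S W := hW.frame (Exec.assign Reg.det 1 s).frame
  refine .seq ((Runs.tabulate (M := (1 : Matrix (Fin q) (Fin q) ℤ)) (le_bitBound_of_le (by omega))
    (mul_le_bitBound hq hq) (by simp [hW₁.var_cols]) (by simp [hW₁.var_cols])
    fun _ _ _ _ => runs_oneEntryProg).mono fun s₂ hF₂ holds => ?_)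
  have hW₂ := hW₁.frame hF₂
  refine (Runs.tabulate (M := Matrix.of fun (_ : Fin 1) (_ : Fin q) => 1)
    (le_bitBound_of_le (by omega)) (by rw [one_mul]; exact le_bitBound_of_le (by omega))
    (by simp [hW₂.var_cols]) (by simp) fun i j s' _ _ _ => ?_).mono fun s₃ hF₃ flag_eq => ?_
  · exact .assign (by simpa using one_le) (by simp)
  · refine ⟨isPivoted_one, fun i j => ?_, ?_, ?_, fun k => ?_⟩
    · have := one_le_entryBound S
      rw [Matrix.one_apply]
      split_ifs <;> simp <;> omega
    · rw [hF₃.var_eq _ (by decide), hF₂.var_eq _ (by decide)]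
      simp [s₁]
    · rw [hF₃.arr_eq _ (by decide), Matrix.adjugate_one]
      exact holds
    · simpa using flag_eq 0 k

theorem runs_productProg (hW : s.HasMatrix S W) (hWB : ∀ i j, |W i j| ≤ entryBound S)
    (h : s.HasPivoted S E M F) {r : Fin p} (hr : s.var Reg.r = (r : ℕ)) :
    Runs (bitBound S) productProg s fun s' =>
      ∀ k : Fin q, s'.arr Arr.prod (k : ℕ) = (W r ᵥ* M.adjugate) k := by
  have hq := hW.cols_le
  refine (Runs.tabulate (M := Matrix.of fun (_ : Fin 1) => W r ᵥ* M.adjugate)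
    (le_bitBound_of_le (by omega)) (by rw [one_mul]; exact le_bitBound_of_le (by omega))
    (by simp [hW.var_cols]) (by simp) ?_).mono fun s' _ holds k => by simpa using holds 0 k
  intro _ j s₁ hF₁ _ hj
  have hW₁ := hW.frame hF₁
  have hB := one_le_entryBound S
  refine Runs.sum (g := fun x => W r x * M.adjugate x j)
    (C := entryBound S * (q.factorial * entryBound S ^ q)) hW₁.var_cols
    (le_bitBound_of_le (by omega)) (fun x => ?_) ?_ fun x s₂ hF₂ hx => ?_
  · rw [abs_mul]
    have := abs_adjugate_le hB h.abs_le x j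
    rw [Fintype.card_fin] at this
    gcongr
    exact hWB r x
  · refine le_trans ?_ (mul_factorial_mul_entryBound_pow_le hq)
    have : 0 ≤ entryBound S := by omega
    gcongr
    omega
  · have hW₂ := hW₁.frame hF₂
    have h₂ := (h.frame hF₁).frame hF₂
    rw [← hW₂.holds, ← h₂.holds]
    simp [hx, hW₂.var_cols, hF₂.var_eq Reg.j (by decide), hj, hF₂.var_eq Reg.r (by decide),
      hF₁.var_eq Reg.r (by decide), hr]

theorem runs_pivotProg (hW : s.HasMatrix S W) (h : s.HasPivoted S E M F) {a : Fin q → ℤ}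
    (ha : ∀ k : Fin q, s.arr Arr.prod (k : ℕ) = a k) :
    Runs (bitBound S) pivotProg s fun s' =>
      (s'.var Reg.pivot = 0 ∧ ∀ k ∈ F, a k = 0) ∨
        ∃ k ∈ F, a k ≠ 0 ∧ s'.var Reg.pivot = (k : ℕ) + 1 := by
  have hq := hW.cols_le
  refine .seq (.assign (by simp) ?_)
  refine Runs.forLoop (n := q) (by simp [hW.var_cols]) (le_bitBound_of_le (by omega)) (by decide)
    (by decide) (fun i s' => (s'.var Reg.pivot = 0 ∧ ∀ k ∈ F, (k : ℕ) < i → a k = 0) ∨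
        ∃ k ∈ F, a k ≠ 0 ∧ s'.var Reg.pivot = (k : ℕ) + 1) (fun i s' v h => by simpa using h)
    (by simp) (fun i s' hF hi hI => ?_) fun s' _ hI => by simpa using hI
  have eval_eq : (Exp.read Arr.flag (.var Reg.x) *
      (.read Arr.prod (.var Reg.x) * .read Arr.prod (.var Reg.x))).eval s' =
      (if i ∈ F then 1 else 0) * (a i * a i) := by
    rw [← h.arr_flag, ← ha]
    simp [hi, hF.arr_eq Arr.flag (by decide), hF.arr_eq Arr.prod (by decide)]
  refine .ite (fun hpos => .assign ?_ (.inr ⟨i, ?_⟩)) fun hneg => .skip ?_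
  · simpa [hi] using abs_natCast_le_two_pow (le_bitBound_of_le (n := i + 1) (S := S) (by omega))
  · rw [eval_eq] at hpos
    split_ifs at hpos with hiF
    · refine ⟨hiF, fun h0 => by simp [h0] at hpos, by simp [hi]⟩
    · simp at hpos
  · refine hI.imp_left fun ⟨pivot_eq, hI⟩ => ⟨pivot_eq, fun k hk hki => ?_⟩
    rcases Nat.lt_succ_iff_lt_or_eq.1 hki with hki | hki
    · exact hI k hk hki
    · obtain rfl := Fin.ext hki
      simpa [eval_eq, hk, mul_self_pos] using hneg

theorem runs_replaceEntryProg (hW : s.HasMatrix S W) (h : s.HasPivoted S E M F)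
    {a : Fin q → ℤ} (ha : ∀ k : Fin q, s.arr Arr.prod (k : ℕ) = (a ᵥ* M.adjugate) k) {k : Fin q}
    (hpivot : s.var Reg.pivot = (k : ℕ)) (habs : ∀ i j, |M.updateRow k a i j| ≤ entryBound S)
    {i j : Fin q} (hi : s.var Reg.i = (i : ℕ)) (hj : s.var Reg.j = (j : ℕ)) :
    Runs (bitBound S) replaceEntryProg s fun s' =>
      s'.var Reg.acc = (M.updateRow k a).adjugate i j := by
  have adj_eq (k' : Fin q) : s.arr Arr.adj ((i : ℕ) * q + (k' : ℕ)) = M.adjugate i k' :=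
    h.holds i k'
  refine .ite (fun hpos => ?_) fun hneg => ?_
  · have hkj : k ≠ j := by
      rintro rfl
      simp [hj, hpivot] at hpos
    have quotient_eq : ((a ᵥ* M.adjugate) k * M.adjugate i j -
        (a ᵥ* M.adjugate) j * M.adjugate i k) / M.det = (M.updateRow k a).adjugate i j := by
      rw [← det_mul_adjugate_updateRow_apply M hkj.symm,
        Int.mul_ediv_cancel_left _ h.isPivoted.det_ne_zero]
    refine .assign ?_ ?_
    · simpa [hi, hj, hW.var_cols, hpivot, ha, adj_eq, h.var_det, quotient_eq] using
        abs_adjugate_le_two_pow habs hW.cols_le i j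
    · simp [hi, hj, hW.var_cols, hpivot, ha, adj_eq, h.var_det, quotient_eq]
  · obtain rfl : k = j := by
      ext
      have : ((j : ℕ) - (k : ℕ) : ℤ) = 0 := by
        by_contra h0
        exact hneg (by simpa [hj, hpivot] using mul_self_pos.2 h0)
      omega
    refine .of_bounded fun hs => .assign (hs.abs_arr_le _ _) ?_
    simp [hi, hj, hW.var_cols, adj_eq, adjugate_updateRow_apply_self]

theorem runs_replaceProg (hW : s.HasMatrix S W) (hWB : ∀ i j, |W i j| ≤ entryBound S)
    (h : s.HasPivoted S E M F) {r : Fin p}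
    (ha : ∀ k : Fin q, s.arr Arr.prod (k : ℕ) = (W r ᵥ* M.adjugate) k)
    {k : Fin q} (hk : k ∈ F) (hk0 : (W r ᵥ* M.adjugate) k ≠ 0)
    (hpivot : s.var Reg.pivot = (k : ℕ)) :
    Runs (bitBound S) replaceProg s
      (·.HasPivoted S (insert (W r) E) (M.updateRow k (W r)) (F.erase k)) := by
  have hq := hW.cols_le
  have abs_updateRow_le (i j : Fin q) : |M.updateRow k (W r) i j| ≤ entryBound S := by
    rw [Matrix.updateRow_apply]
    split_ifs
    exacts [hWB r j, h.abs_le i j]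
  refine .seq ((Runs.tabulate (M := (M.updateRow k (W r)).adjugate)
    (le_bitBound_of_le (by omega)) (mul_le_bitBound hq hq) (by simp [hW.var_cols])
    (by simp [hW.var_cols]) fun i j s' hF => ?_).mono fun s₁ hF₁ holds₁ => .of_bounded fun hs₁ =>
      .seq (.assign (hs₁.abs_arr_le _ _) (.write (by simp) ?_)))
  · exact runs_replaceEntryProg (hW.frame hF) (h.frame hF)
      (fun k' => by rw [hF.arr_eq _ (by decide), ha])
      ((hF.var_eq _ (by decide)).trans hpivot) abs_updateRow_le
  · have pivot_eq : s₁.var Reg.pivot = (k : ℕ) := (hF₁.var_eq _ (by decide)).trans hpivot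
    refine ⟨h.isPivoted.insert_of_dotProduct_ne_zero hk hk0, abs_updateRow_le, ?_, holds₁,
      fun k' => ?_⟩
    · simp [pivot_eq, hF₁.arr_eq Arr.prod (by decide), ha, det_updateRow_eq_vecMul_adjugate]
    · by_cases hkk' : k' = k <;>
        simp [pivot_eq, hF₁.arr_eq Arr.flag (by decide), h.arr_flag, hkk', Fin.val_inj]

theorem runs_stepProg (hW : s.HasMatrix S W) (hWB : ∀ i j, |W i j| ≤ entryBound S)
    (h : s.HasPivoted S E M F) {r : Fin p} (hr : s.var Reg.r = (r : ℕ)) :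
    Runs (bitBound S) stepProg s fun s' => ∃ M' F', s'.HasPivoted S (insert (W r) E) M' F' := by
  refine .seq ((runs_productProg hW hWB h hr).mono fun s₁ hF₁ ha => ?_)
  have hW₁ := hW.frame hF₁
  have h₁ := h.frame hF₁
  refine .seq ((runs_pivotProg hW₁ h₁ ha).mono fun s₂ hF₂ hpivot => ?_)
  have hW₂ := hW₁.frame hF₂
  have h₂ := h₁.frame hF₂
  rcases hpivot with ⟨hpivot, hzero⟩ | ⟨k, hk, hk0, hpivot⟩
  · refine .ite (fun hpos => by simp [hpivot] at hpos) fun _ => .skip ⟨M, F, ?_⟩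
    exact { h₂ with isPivoted := h.isPivoted.insert_of_dotProduct_eq_zero hzero }
  · have pivot_sub_one : (Exp.var Reg.pivot - 1).eval s₂ = (k : ℕ) := by simp [hpivot]
    refine .ite (fun _ => .seq (.assign ?_ ?_)) fun hneg => ?_
    · rw [pivot_sub_one]
      exact abs_natCast_le_two_pow (le_bitBound_of_le (by have := hW.cols_le; omega))
    · have hF₃ := (Exec.assign Reg.pivot (.var Reg.pivot - 1) s₂).frame
      refine (runs_replaceProg (hW₂.frame hF₃) hWB (h₂.frame hF₃) (r := r) (fun k => ?_) hk hk0
        (by simp [hpivot])).mono fun _ _ h' => ⟨_, _, h'⟩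
      simpa [hF₂.arr_eq Arr.prod (by decide)] using ha k
    · refine absurd ?_ hneg
      simp only [Exp.eval_var, hpivot]
      positivity

theorem runs_eliminateProg (hW : s.HasMatrix S W) (hWB : ∀ i j, |W i j| ≤ entryBound S) :
    Runs (bitBound S) eliminateProg s fun s' => ∃ M F, s'.HasPivoted S (Set.range W.row) M F := by
  refine .seq ((runs_initProg hW).mono fun s₁ hF₁ h₁ => ?_)
  have hW₁ := hW.frame hF₁
  refine Runs.forLoop hW₁.var_rows (le_bitBound_of_le (by have := hW.rows_le; omega)) (by decide)
    (by decide) (fun i s' => ∃ M F, s'.HasPivoted S (W.row '' {k | k.val < i}) M F) ?_ ?_ ?_ ?_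
  · rintro i s' v ⟨M, F, h⟩
    exact ⟨M, F, { h with var_det := by simpa using h.var_det }⟩
  · exact ⟨1, Finset.univ, by simpa using h₁⟩
  · rintro r s₂ hF₂ hr ⟨M, F, h₂⟩
    have insert_eq : {k : Fin p | k.val < r + 1} = insert r {k : Fin p | k.val < r} := by
      ext k
      simp only [Set.mem_ofPred_eq, Set.mem_insert_iff, Fin.ext_iff]
      omega
    rw [insert_eq, Set.image_insert_eq]
    exact runs_stepProg (hW₁.frame hF₂) hWB h₂ hr
  · rintro s₂ - ⟨M, F, h₂⟩
    exact ⟨M, F, by simpa using h₂⟩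

theorem runs_freeProg (hq : q ≤ S) (hcols : s.var Reg.cols = q) (h : s.HasPivoted S E M F) :
    Runs (bitBound S) freeProg s (·.HoldsList Reg.freeCount Arr.free
      (((List.finRange q).filter (· ∈ F)).map fun k : Fin q => (k.val : ℤ))) := by
  have appends : Appends (bitBound S) Reg.freeCount Arr.free
      (forLoop Reg.x Reg.cols
        (.ite (.read Arr.flag (.var Reg.x)) (append Reg.freeCount Arr.free (.var Reg.x)) .skip))
      (s.setVar Reg.freeCount 0)
      ((List.finRange q).flatMap fun k => if k ∈ F then [((k : ℕ) : ℤ)] else []) := by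
    refine .forLoop (by simp [hcols]) (le_bitBound_of_le (by omega)) fun k s' hF hk => ?_
    have flag_eq : (Exp.read Arr.flag (.var Reg.x)).eval s' = if k ∈ F then 1 else 0 := by
      rw [← h.arr_flag, Exp.eval_read, Exp.eval_var, hk, hF.arr_eq _ (by decide), Store.arr_setVar]
    split_ifs at flag_eq ⊢
    · refine .ite_pos (by simp [flag_eq]) ?_
      have append_x := Appends.append (N := bitBound S) (x := Reg.freeCount) (a := Arr.free)
        (s := s') (e := .var Reg.x) (by
          simpa [hk] using abs_natCast_le_two_pow (le_bitBound_of_le (n := k) (S := S) (by omega)))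
      rwa [Exp.eval_var, hk] at append_x
    · exact .ite_neg (by simp [flag_eq]) .skip
  have flatMap_eq : (List.finRange q).flatMap (fun k => if k ∈ F then [((k : ℕ) : ℤ)] else []) =
      ((List.finRange q).filter (· ∈ F)).map fun k : Fin q => (k.val : ℤ) := by
    induction List.finRange q with
    | nil => rfl
    | cons k l ih => by_cases hk : k ∈ F <;> simp [hk, ih]
  rw [flatMap_eq] at appends
  refine .seq (.assign (by simp) (appends [] (by simp [Store.HoldsList]) ?_))
  have := List.length_filter_le (· ∈ F) (List.finRange q)
  rw [List.length_finRange] at this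
  simpa using le_bitBound_of_le (by omega)

theorem runs_selectProg (hq : q ≤ S) (hcols : s.var Reg.cols = q)
    (hM : HoldsMatrix (s.arr Arr.adj) M) {l : List (Fin q)} (hl : l.length ≤ S)
    (hfree : s.HoldsList Reg.freeCount Arr.free (l.map fun k : Fin q => (k.val : ℤ))) :
    Runs (bitBound S) selectProg s (·.HasMatrix S (M.submatrix id l.get)) := by
  have freeCount_eq : s.var Reg.freeCount = l.length := by simpa using hfree.1
  refine .seq ((Runs.tabulate (M := M.submatrix id l.get) (le_bitBound_of_le (by omega))
    (mul_le_bitBound hq hl) (by simp [freeCount_eq]) (by simp [hcols]) ?_).mono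
    fun s₁ hF₁ holds => ?_)
  · intro i j s' hF hi hj
    have free_eq : s'.arr Arr.free (j : ℕ) = (l.get j : ℕ) := by
      rw [hF.arr_eq _ (by decide), hfree.2 _ (by simp)]
      simp
    have cols_eq : s'.var Reg.cols = q := (hF.var_eq _ (by decide)).trans hcols
    refine .of_bounded fun hs' => .assign (hs'.abs_arr_le _ _) ?_
    rw [Matrix.submatrix_apply, id, ← hM]
    simp [hi, hj, free_eq, cols_eq, hF.arr_eq Arr.adj (by decide)]
  · have cols_eq : s₁.var Reg.cols = q := (hF₁.var_eq _ (by decide)).trans hcols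
    have freeCount_eq₁ : s₁.var Reg.freeCount = l.length :=
      (hF₁.var_eq _ (by decide)).trans freeCount_eq
    refine .of_bounded fun hs₁ => .seq (.assign (hs₁.abs_var_le _) (.assign ?_ ?_))
    · simpa using hs₁.abs_var_le Reg.freeCount
    · exact ⟨hq, hl, by simp [cols_eq], by simp [freeCount_eq₁], holds⟩

theorem runs_kernelProg (hW : s.HasMatrix S W) (hWB : ∀ i j, |W i j| ≤ entryBound S) :
    Runs (bitBound S) kernelProg s fun s' => ∃ (k : ℕ) (K : Matrix (Fin q) (Fin k) ℤ),
      IsFullNullMatrix (W.map (Int.cast : ℤ → ℚ)) (K.map (Int.cast : ℤ → ℚ)) ∧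
        s'.HasMatrix S K := by
  have hq := hW.cols_le
  refine .seq ((runs_eliminateProg hW hWB).mono fun s₁ hF₁ ⟨M, F, h₁⟩ => ?_)
  have hcols₁ : s₁.var Reg.cols = q := (hF₁.var_eq _ (by decide)).trans hW.var_cols
  refine .seq ((runs_freeProg hq hcols₁ h₁).mono fun s₂ hF₂ hfree => ?_)
  have hcols₂ : s₂.var Reg.cols = q := (hF₂.var_eq _ (by decide)).trans hcols₁
  set l := (List.finRange q).filter (· ∈ F)
  have length_le : l.length ≤ q := by
    simpa using List.length_filter_le (· ∈ F) (List.finRange q)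
  have get_injective : Function.Injective l.get :=
    ((List.nodup_finRange q).filter _).injective_get
  have range_get : Set.range l.get = F := by
    ext k
    simp [l, Set.range_list_get]
  exact (runs_selectProg hq hcols₂ (h₁.frame hF₂).holds (length_le.trans hq) hfree).mono
    fun s₃ _ h₃ => ⟨_, _, h₁.isPivoted.isFullNullMatrix get_injective range_get, h₃⟩

end Kernel

/-! ### The two reductions -/

/-- Compute a full null matrix for the input matrix. -/
def nullMatrixProg : Prog :=
  loadProg ;; kernelProg ;; emitProg

/-- Compute a matrix for which the input matrix is a full null matrix, if there is one. -/
def annihilatorProg : Prog :=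
  loadProg ;; transposeProg ;; kernelProg ;; transposeProg ;; emitProg

theorem Store.holdsList_init (w : List ℤ) (ws : List (List ℤ)) :
    (Store.init (w :: ws)).HoldsList Reg.outLen Arr.io w := by
  simp [HoldsList, Store.init]

theorem runs_nullMatrixProg (A : RatMatrix) :
    Runs (bitBound (wordSize A.code)) nullMatrixProg (Store.init [A.code]) fun s =>
      ∃ N ∈ sparseNullSpace.S A, s.Outputs N.code := by
  refine .seq ((runs_loadProg (Store.holdsList_init _ _)).mono fun s₁ _ h₁ => ?_)
  refine .seq ((runs_kernelProg h₁ A.abs_cleared_le).mono fun s₂ _ ⟨k, K, hK, h₂⟩ => ?_)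
  refine (runs_emitProg h₂).mono fun s₃ _ h₃ => ⟨_, ⟨k, _, rfl, ?_⟩, h₃⟩
  rwa [← A.commonDen_smul_entries,
    isFullNullMatrix_smul_iff (by exact_mod_cast A.commonDen_ne_zero)] at hK

theorem runs_annihilatorProg {B : RatMatrix} (hB : B.FullRank) :
    Runs (bitBound (wordSize B.code)) annihilatorProg (Store.init [B.code]) fun s =>
      ∃ A, B ∈ sparseNullSpace.S A ∧ s.Outputs A.code := by
  refine .seq ((runs_loadProg (Store.holdsList_init _ _)).mono fun s₁ _ h₁ => ?_)
  refine .seq ((runs_transposeProg h₁).mono fun s₂ _ h₂ => ?_)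
  refine .seq ((runs_kernelProg h₂ fun i j => B.abs_cleared_le j i).mono
    fun s₃ _ ⟨k, K, hK, h₃⟩ => ?_)
  refine .seq ((runs_transposeProg h₃).mono fun s₄ _ h₄ => ?_)
  refine (runs_emitProg h₄).mono fun s₅ _ h₅ => ⟨_, ⟨B.cols, B.entries, rfl, ?_⟩, h₅⟩
  rw [Matrix.transpose_map, ← B.commonDen_smul_entries, Matrix.transpose_smul,
    isFullNullMatrix_smul_iff (by exact_mod_cast B.commonDen_ne_zero)] at hK
  exact hK.transpose hB

theorem eval_X_add_two_pow (n : ℕ) :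
    ((Polynomial.X + 2) ^ 3 : Polynomial ℕ).eval n = bitBound n := by
  simp [bitBound]

theorem exists_polyTime_mem_sparseNullSpace :
    ∃ t : RatMatrix → {B : RatMatrix // B.FullRank},
      PolyTime (fun A => [A.code]) (fun B => B.1.code) t ∧
        ∀ A, (t A).1 ∈ sparseNullSpace.S A := by
  refine exists_polyTime_of_runs
    (P := fun (A : RatMatrix) (N : {N : RatMatrix // N.FullRank}) => N.1 ∈ sparseNullSpace.S A)
    nullMatrixProg ((Polynomial.X + 2) ^ 3) (fun n => ?_) fun A => ?_
  · rw [eval_X_add_two_pow]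
    exact le_bitBound_of_le (by omega)
  · rw [eval_X_add_two_pow, List.map_singleton, List.sum_singleton]
    exact (runs_nullMatrixProg A).mono fun s _ ⟨N, hN, output⟩ =>
      ⟨⟨N, fullRank_of_mem_sparseNullSpace hN⟩, hN, output⟩

theorem exists_polyTime_sparseNullSpace_mem :
    ∃ u : {B : RatMatrix // B.FullRank} → RatMatrix,
      PolyTime (fun B => [B.1.code]) RatMatrix.code u ∧
        ∀ B, B.1 ∈ sparseNullSpace.S (u B) := by
  refine exists_polyTime_of_runs
    (P := fun (B : {B : RatMatrix // B.FullRank}) (A : RatMatrix) => B.1 ∈ sparseNullSpace.S A)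
    annihilatorProg ((Polynomial.X + 2) ^ 3) (fun n => ?_) fun B => ?_
  · rw [eval_X_add_two_pow]
    exact le_bitBound_of_le (by omega)
  · rw [eval_X_add_two_pow, List.map_singleton, List.sum_singleton]
    exact runs_annihilatorProg B.2

/-- Output the second input word. -/
def secondWordProg : Prog :=
  Reg.outLen ::= 0 ;; forLoop Reg.z 1 (append Reg.outLen Arr.io (.read 1 (.var Reg.z)))

theorem runs_secondWordProg {N : ℕ} {u w : List ℤ} (hw : w.length ≤ N) :
    Runs N secondWordProg (Store.init [u, w]) (·.Outputs w) := by
  have appends : Appends N Reg.outLen Arr.io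
      (forLoop Reg.z 1 (append Reg.outLen Arr.io (.read 1 (.var Reg.z))))
      ((Store.init [u, w]).setVar Reg.outLen 0)
      ((List.finRange w.length).flatMap fun i => [w[i]]) := by
    refine .forLoop (by simp [Store.init]) hw fun i s hF hi => ?_
    have entry_eq : (Exp.read 1 (.var Reg.z)).eval s = w[i] := by
      simp [hi, hF.arr_eq 1 (by decide), Store.init]
    rw [← entry_eq]
    exact fun v hv hN => .of_bounded fun hs => Appends.append (hs.abs_arr_le _ _) v hv hN
  have flatMap_eq : (List.finRange w.length).flatMap (fun i => [w[i]]) = w := by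
    rw [← List.map_eq_flatMap]
    exact List.map_getElem_finRange w
  rw [flatMap_eq] at appends
  exact .seq (.assign (by simp) (appends [] (by simp [Store.HoldsList]) hw))

theorem polyTime_of_encOut_eq_snd {α β γ : Type} {enc₁ : α → List ℤ} {enc₂ : β → List ℤ}
    {encOut : γ → List ℤ} {f : α × β → γ} (hf : ∀ p, encOut (f p) = enc₂ p.2) :
    PolyTime (fun p => [enc₁ p.1, enc₂ p.2]) encOut f := by
  have length_le (p : α × β) : (enc₂ p.2).length ≤
      Polynomial.X.eval ([enc₁ p.1, enc₂ p.2].map wordSize).sum := by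
    simpa using (length_le_wordSize _).trans (Nat.le_add_left _ _)
  obtain ⟨g, hg, hgf⟩ := exists_polyTime_of_runs (P := fun p c => c = f p)
    (encIn := fun p : α × β => [enc₁ p.1, enc₂ p.2]) (encOut := encOut)
    secondWordProg Polynomial.X (by simp) fun p =>
      (runs_secondWordProg (u := enc₁ p.1) (length_le p)).mono fun s _ output =>
        ⟨f p, rfl, by rwa [hf]⟩
  rwa [funext hgf] at hg

theorem exactlyReducible_of_image_eq {F G : MinProblem} {t : F.Inst → G.Inst}
    (ht : PolyTime (fun x => [F.encInst x]) G.encInst t) (e : G.Sol → F.Sol)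
    (henc : ∀ y, F.encSol (e y) = G.encSol y) (hS : ∀ x, e '' G.S (t x) = F.S x)
    (hM : ∀ x y, F.M x (e y) = G.M (t x) y) :
    ExactlyReducible F G := by
  refine ⟨t, fun p => e p.2, ht, polyTime_of_encOut_eq_snd fun p => henc p.2,
    fun x y hy => ?_, fun x y _ => hM x y, fun x => le_iInf₂ fun z hz => ?_⟩
  · exact hS x ▸ Set.mem_image_of_mem e hy
  · obtain ⟨y, hy, rfl⟩ := (hS x).symm ▸ hz
    exact iInf₂_le_of_le y hy (by rw [hM])

end SparseMat

theorem mainTheorem5 :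
    SparseMat.Equivalent SparseMat.matrixSparsification SparseMat.sparseNullSpace := by
  obtain ⟨t, polyTime_t, t_mem⟩ := SparseMat.exists_polyTime_mem_sparseNullSpace
  obtain ⟨u, polyTime_u, mem_u⟩ := SparseMat.exists_polyTime_sparseNullSpace_mem
  exact ⟨
    SparseMat.exactlyReducible_of_image_eq polyTime_u id (fun _ => rfl)
      (fun B => (Set.image_id _).trans
        (SparseMat.sparseNullSpace_S_eq_matrixSparsification_S (mem_u B) B.2)) fun _ _ => rfl,
    SparseMat.exactlyReducible_of_image_eq polyTime_t id (fun _ => rfl)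
      (fun A => (Set.image_id _).trans
        (SparseMat.sparseNullSpace_S_eq_matrixSparsification_S (t_mem A) (t A).2).symm)
      fun _ _ => rfl⟩
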